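/- Let $G$ be a compact (Hausdorff) group with neutral element $e$, and let $\widehat G$ be the set of equivalence classes of its irreducible representations, each $\pi\in\widehat G$ being represented by a continuous irreducible unitary matrix representation of dimension $d_\pi$ with coordinate functions $\pi_{ij}(\sigma)=\pi(\sigma)_{ij}$. Let $(\mu_t,\,t\ge 0)$ be a vaguely continuous convolution semigroup of Borel probability measures on $G$ with $\mu_0=\delta_e$, such that every $\mu_t$ is central ($\mu_t(\sigma A\sigma^{-1})=\mu_t(A)$) and symmetric ($\mu_t(A^{-1})=\mu_t(A)$). Let $L^2(G)=L^2(G,\mathbb C)$ with respect to normalized Haar measure, and let $T_t$ be the bounded operator on $L^2(G)$ extending $T_tf(\sigma)=\int_G f(\sigma\tau)\,\mu_t(d\tau)$, $f\in C(G)$. Then for each $\pi\in\widehat G$ there is a real number $\alpha_\pi\le 0$ with $\int_G\pi(\sigma)\,\mu_t(d\sigma)=e^{t\alpha_\pi}I_\pi$ for all $t\ge 0$, and the following hold. (1) For each $t\ge 0$, the set $\{\pi_{ij}:1\le i,j\le d_\pi,\ \pi\in\widehat G\}$ is a complete orthogonal set of eigenvectors of $T_t$ in $L^2(G)$, and $$T_t\pi_{ij}=e^{t\alpha_\pi}\pi_{ij}\qquad(1\le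 i,j\le d_\pi,\ \pi\in\widehat G).$$ (2) If for each $t>0$ the measure $\mu_t$ has a continuous density $k_t$ with respect to normalized Haar measure, then for each $t>0$ the operator $T_t$ on $L^2(G)$ is trace class and $$k_t(e)=\mathrm{Tr}(T_t)=\sum_{\pi\in\widehat G}d_\pi^2e^{t\alpha_\pi}.$$ -/

import Mathlib

open MeasureTheory Matrix
open scoped NNReal ENNReal ComplexConjugate Pointwise InnerProductSpace

noncomputable section

namespace HuntSemigroup

/-! ### Trace-class operators on a complex Hilbert space -/

section Trace

universe u

variable {H : Type u} [NormedAddCommGroup H] [InnerProductSpace ℂ H] [CompleteSpace H]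

/-- `T` is trace class: for every orthonormal basis `b`, `∑ ⟪b i, |T| b i⟫ < ∞`, where
`|T| = (T* T) ^ (1/2)`. (Every orthonormal basis of `H` can be indexed by a type in the universe
of `H`, for instance by its own set of vectors.) -/
def IsTraceClass (T : H →L[ℂ] H) : Prop :=
  ∀ (ι : Type u) (b : HilbertBasis ι ℂ H),
    Summable fun i => (⟪b i, CFC.abs T (b i)⟫_ℂ).re

/-- `T` is trace class and `Tr T = c`, that is, `∑ ⟪b i, T b i⟫ = c` for every orthonormal
basis `b`. -/
def HasTrace (T : H →L[ℂ] H) (c : ℂ) : Prop :=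
  IsTraceClass T ∧
    ∀ (ι : Type u) (b : HilbertBasis ι ℂ H), HasSum (fun i => ⟪b i, T (b i)⟫_ℂ) c

end Trace

variable {G : Type*} [Group G] [TopologicalSpace G]

/-! ### Irreducible unitary matrix representations and the unitary dual -/

/-- The representation on `ℂ^d` given by a group of unitary matrices. -/
def matrixRep {d : ℕ} (ρ : G →* unitaryGroup (Fin d) ℂ) : Representation ℂ G (Fin d → ℂ) :=
  (Matrix.toLinAlgEquiv' : Matrix (Fin d) (Fin d) ℂ ≃ₐ[ℂ] _).toRingEquiv.toMonoidHom.comp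
    ((unitaryGroup (Fin d) ℂ).subtype.comp ρ)

variable (G) in
/-- A continuous irreducible representation of `G` by unitary `dim × dim` matrices. -/
structure UnitaryIrrep where
  /-- the dimension `d_π` -/
  dim : ℕ
  /-- the homomorphism `σ ↦ π(σ)` -/
  hom : G →* unitaryGroup (Fin dim) ℂ
  continuous_hom : Continuous hom
  irreducible : (matrixRep hom).IsIrreducible

variable (G) in
/-- Equivalence of irreducible representations (existence of an invertible intertwiner). -/
instance UnitaryIrrep.setoid : Setoid (UnitaryIrrep G) where
  r π ρ := Nonempty ((matrixRep π.hom).Equiv (matrixRep ρ.hom))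
  iseqv :=
    { refl := fun _ => ⟨Representation.Equiv.refl _⟩
      symm := fun ⟨e⟩ => ⟨e.symm⟩
      trans := fun ⟨e⟩ ⟨f⟩ => ⟨e.trans f⟩ }

variable (G) in
/-- The set `Ĝ` of equivalence classes of irreducible representations. -/
abbrev UnitaryDual := Quotient (UnitaryIrrep.setoid G)

/-- The matrix coefficient `π_ij : σ ↦ π(σ)_ij`, a continuous function on `G`. -/
def UnitaryIrrep.coeff (π : UnitaryIrrep G) (i j : Fin π.dim) : C(G, ℂ) where
  toFun σ := (π.hom σ : Matrix (Fin π.dim) (Fin π.dim) ℂ) i j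
  continuous_toFun :=
    (continuous_subtype_val.comp π.continuous_hom).matrix_elem i j

/-! ### Measures on a compact group -/

variable [MeasurableSpace G]

/-- The Fourier transform `∫ π(σ) μ(dσ)` of a measure. -/
def measureFourier (μ : Measure G) (π : UnitaryIrrep G) : Matrix (Fin π.dim) (Fin π.dim) ℂ :=
  Matrix.of fun i j => ∫ σ, π.coeff i j σ ∂μ

/-- `μ(σ A σ⁻¹) = μ(A)` for all `σ` and all Borel sets `A`. -/
def IsCentral (μ : Measure G) : Prop :=
  ∀ (σ : G) (A : Set G), MeasurableSet A → μ ((fun x => σ * x * σ⁻¹) '' A) = μ A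

/-- `μ(A⁻¹) = μ(A)` for all Borel sets `A`. -/
def IsSymmetric (μ : Measure G) : Prop :=
  ∀ A : Set G, MeasurableSet A → μ A⁻¹ = μ A

variable [IsTopologicalGroup G] [CompactSpace G] [BorelSpace G]

/-- A vaguely continuous convolution semigroup `(μ_t, t ≥ 0)` of probability measures on the
compact group `G` with `μ_0 = δ_e`. The convolution `μ_s * μ_t` is the measure with
`∫ f d(μ_s * μ_t) = ∫∫ f(στ) μ_s(dσ) μ_t(dτ)` for continuous `f`; in this form it makes sense
also when the Borel sets of `G × G` are not generated by rectangles. On a compact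
group the topology of `ProbabilityMeasure G` (test functions: bounded continuous functions) is
the vague topology. -/
structure IsConvolutionSemigroup (μ : ℝ≥0 → ProbabilityMeasure G) : Prop where
  zero : (μ 0 : Measure G) = Measure.dirac 1
  conv : ∀ (s t : ℝ≥0) (f : C(G, ℂ)),
    ∫ x, f x ∂(μ (s + t) : Measure G) =
      ∫ σ, ∫ τ, f (σ * τ) ∂(μ t : Measure G) ∂(μ s : Measure G)
  continuous : Continuous μ

variable (G) in
/-- Normalized Haar measure on `G`. -/
abbrev haar : Measure G := Measure.haarMeasure ⊤

variable (G) in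
/-- `L²(G) = L²(G, ℂ)` with respect to normalized Haar measure. -/
abbrev L2 := Lp ℂ 2 (haar G)

variable (G) in
/-- The canonical map `C(G) → L²(G)`. -/
abbrev toL2 : C(G, ℂ) →L[ℂ] L2 G := ContinuousMap.toLp 2 (haar G) ℂ

/-- `k` is a density of `μ` with respect to normalized Haar measure. -/
def IsDensity (μ : Measure G) (k : G → ℝ) : Prop :=
  AEMeasurable k (haar G) ∧ 0 ≤ᵐ[haar G] k ∧
    μ = (haar G).withDensity fun σ => ENNReal.ofReal (k σ)

/-! ### The Hunt operator of a probability measure -/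

theorem continuous_integral_mul (μ : ProbabilityMeasure G) (f : C(G, ℂ)) :
    Continuous fun σ => ∫ τ, f (σ * τ) ∂(μ : Measure G) := by
  rw [← continuousOn_univ]
  refine continuousOn_integral_of_compact_support (k := Set.univ) isCompact_univ ?_ ?_
  · exact (f.continuous.comp continuous_mul).continuousOn
  · intro p x _ hx
    exact absurd (Set.mem_univ x) hx

theorem integrable_of_continuous {E : Type*} [NormedAddCommGroup E]
    (μ : Measure G) [IsFiniteMeasure μ] {f : G → E} (hf : Continuous f) : Integrable f μ :=
  hf.integrable_of_hasCompactSupport (HasCompactSupport.of_compactSpace f)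

/-- The operator `(T f)(σ) = ∫ f(στ) μ(dτ)` on `C(G)`. -/
def huntC (μ : ProbabilityMeasure G) : C(G, ℂ) →ₗ[ℂ] C(G, ℂ) where
  toFun f := ⟨fun σ => ∫ τ, f (σ * τ) ∂(μ : Measure G), continuous_integral_mul μ f⟩
  map_add' f g := by
    ext σ
    exact integral_add
      (integrable_of_continuous _ (f.continuous.comp (continuous_const_mul σ)))
      (integrable_of_continuous _ (g.continuous.comp (continuous_const_mul σ)))
  map_smul' c f := by
    ext σ
    exact integral_const_mul c _

/-- The operator `T` on `L²(G)`: the continuous extension of `(T f)(σ) = ∫ f(στ) μ(dτ)` from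
`C(G)` to `L²(G)`. That this extension exists is `hunt_toL2` below. -/
def hunt (μ : ProbabilityMeasure G) : L2 G →L[ℂ] L2 G :=
  ((toL2 G).toLinearMap ∘ₗ huntC μ).extendOfNorm (toL2 G).toLinearMap

theorem integral_haar_mul_right (g : G → ℝ) (τ : G) :
    ∫ σ, g (σ * τ) ∂haar G = ∫ σ, g σ ∂haar G := by
  have huniv : haar G Set.univ = 1 := Measure.haarMeasure_self
  have : IsProbabilityMeasure (haar G) := ⟨huniv⟩
  have : IsProbabilityMeasure (Measure.map (· * τ) (haar G)) :=
    Measure.isProbabilityMeasure_map (measurable_mul_const τ).aemeasurable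
  have h : Measure.map (· * τ) (haar G) = haar G :=
    Measure.isHaarMeasure_eq_of_isProbabilityMeasure _ _
  conv_rhs => rw [← h]
  exact ((Homeomorph.mulRight τ).measurableEmbedding.integral_map g).symm

theorem norm_toL2_sq (f : C(G, ℂ)) : ‖toL2 G f‖ ^ 2 = ∫ σ, ‖f σ‖ ^ 2 ∂haar G := by
  have h := ContinuousMap.inner_toLp (𝕜 := ℂ) (haar G) f f
  rw [inner_self_eq_norm_sq_to_K] at h
  have h2 : ∀ x, f x * (starRingEnd ℂ) (f x) = ((‖f x‖ ^ 2 : ℝ) : ℂ) := fun x => by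
    rw [Complex.mul_conj']
    push_cast
    rfl
  simp only [h2] at h
  rw [integral_complex_ofReal] at h
  apply Complex.ofReal_injective
  rw [← h]
  exact Complex.ofReal_pow _ _

theorem norm_toL2_huntC_le (μ : ProbabilityMeasure G) (f : C(G, ℂ)) :
    ‖toL2 G (huntC μ f)‖ ≤ ‖toL2 G f‖ := by
  have huniv : haar G Set.univ = 1 := Measure.haarMeasure_self
  have : IsProbabilityMeasure (haar G) := ⟨huniv⟩
  have hc : Continuous fun p : G × G => ‖f (p.1 * p.2)‖ ^ 2 :=
    (f.continuous.comp continuous_mul).norm.pow 2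
  have hc1 : ∀ σ, Continuous fun τ => ‖f (σ * τ)‖ ^ 2 := fun σ =>
    hc.comp (Continuous.prodMk_right σ)
  have hint : Continuous fun σ => ∫ τ, ‖f (σ * τ)‖ ^ 2 ∂(μ : Measure G) := by
    rw [← continuousOn_univ]
    exact continuousOn_integral_of_compact_support (k := Set.univ) isCompact_univ
      hc.continuousOn (fun p x _ hx => absurd (Set.mem_univ x) hx)
  have hJ : ∀ σ, ‖huntC μ f σ‖ ^ 2 ≤ ∫ τ, ‖f (σ * τ)‖ ^ 2 ∂(μ : Measure G) := by
    intro σ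
    have hn : Continuous fun τ => ‖f (σ * τ)‖ :=
      (f.continuous.comp (continuous_const_mul σ)).norm
    have h1 : ‖huntC μ f σ‖ ≤ ∫ τ, ‖f (σ * τ)‖ ∂(μ : Measure G) :=
      norm_integral_le_integral_norm _
    have h2 : (∫ τ, ‖f (σ * τ)‖ ∂(μ : Measure G)) ^ 2 ≤
        ∫ τ, ‖f (σ * τ)‖ ^ 2 ∂(μ : Measure G) :=
      (convexOn_pow 2).map_integral_le (continuous_pow 2).continuousOn isClosed_Ici
        (Filter.Eventually.of_forall fun τ => norm_nonneg (f (σ * τ)))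
        (integrable_of_continuous _ hn) (integrable_of_continuous _ (hc1 σ))
    exact (pow_le_pow_left₀ (norm_nonneg _) h1 2).trans h2
  refine le_of_sq_le_sq ?_ (norm_nonneg _)
  rw [norm_toL2_sq, norm_toL2_sq]
  calc ∫ σ, ‖huntC μ f σ‖ ^ 2 ∂haar G
      ≤ ∫ σ, ∫ τ, ‖f (σ * τ)‖ ^ 2 ∂(μ : Measure G) ∂haar G :=
        integral_mono (integrable_of_continuous _ ((huntC μ f).continuous.norm.pow 2))
          (integrable_of_continuous _ hint) hJ
    _ = ∫ τ, ∫ σ, ‖f (σ * τ)‖ ^ 2 ∂haar G ∂(μ : Measure G) :=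
        integral_integral_swap_of_hasCompactSupport
          (f := fun σ τ => ‖f (σ * τ)‖ ^ 2) hc (HasCompactSupport.of_compactSpace _)
    _ = ∫ σ, ‖f σ‖ ^ 2 ∂haar G := by
        simp_rw [integral_haar_mul_right fun σ => ‖f σ‖ ^ 2]
        simp

/-- `hunt μ` does extend the operator on `C(G)`. -/
theorem hunt_toL2 [T2Space G] (μ : ProbabilityMeasure G) (f : C(G, ℂ)) :
    hunt μ (toL2 G f) = toL2 G (huntC μ f) := by
  refine LinearMap.extendOfNorm_eq (f := (toL2 G).toLinearMap ∘ₗ huntC μ)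
    (e := (toL2 G).toLinearMap) ?_ ⟨1, fun x => ?_⟩ f
  · exact ContinuousMap.toLp_denseRange ℂ (haar G) ℂ (by norm_num)
  · simpa using norm_toL2_huntC_le μ x

end HuntSemigroup

end

open HuntSemigroup

set_option linter.unusedSectionVars false

noncomputable section

namespace HuntSemigroup

/-! ### Invariance of Haar measure and the right regular representation. -/

section RightRegular

variable {G : Type*} [Group G] [TopologicalSpace G] [IsTopologicalGroup G] [CompactSpace G]
  [MeasurableSpace G] [BorelSpace G]

/-! Centrality makes the matrix `∫ π dμ_t` commute with every `π(σ)`, so Schur's lemma makes it a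
scalar. Symmetry makes the scalar real, the convolution identity makes it multiplicative in `t`, and
vague continuity together with `|π_ii| ≤ 1` leaves only `exp (t * a)` with `a ≤ 0`
(`exists_exponent`). Since `π(στ) = π(σ)π(τ)`, this scalar is the eigenvalue of `T_t` on each
coefficient (`hunt_toL2_coeff`). Orthogonality comes from the Schur relations (`inner_coeff`) and
completeness from Peter–Weyl (`orthogonal_map_coeffSpan`).

Peter–Weyl is proved by compact operators. If `A` is convolution on the left by a continuous kernel,
then `A A*` is compact, self-adjoint and commutes with right translations. Its eigenspaces for
nonzero eigenvalues are therefore finite-dimensional representations, and their elements are matrix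
coefficients. A vector `g` orthogonal to all coefficients is thus orthogonal to the range of every
such `A`. Choosing the kernel in terms of `g` itself then forces `g = 0`, with no approximate
identity.

For the trace everything is halved: `T_t` is the square of the self-adjoint diagonal operator
`T_{t/2}`. In any orthonormal basis its trace is therefore the squared Hilbert–Schmidt norm of
`T_{t/2}`, which is `∑ d_π² e^{tα_π}` (`hasTrace_hunt`). Also `k_t = T_{t/2} k_{t/2}` pointwise, so
`k_t(e) = ‖k_{t/2}‖²`, and Parseval gives the same sum (`hasSum_dim_sq`). No pointwise convergence
of a Fourier series is needed. -/

instance isProbabilityMeasure_haar : IsProbabilityMeasure (haar G) :=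
  ⟨Measure.haarMeasure_self⟩

instance isMulRightInvariant_haar : (haar G).IsMulRightInvariant := by
  refine ⟨fun τ => ?_⟩
  have : IsProbabilityMeasure (Measure.map (· * τ) (haar G)) :=
    Measure.isProbabilityMeasure_map (measurable_mul_const τ).aemeasurable
  exact Measure.isHaarMeasure_eq_of_isProbabilityMeasure _ _

/-- Inversion turns right invariance into left invariance, so the inverted measure is again a Haar
probability measure, and that is unique. -/
instance isInvInvariant_haar : (haar G).IsInvInvariant := by
  refine ⟨?_⟩
  have : IsProbabilityMeasure (haar G).inv :=
    Measure.isProbabilityMeasure_map measurable_inv.aemeasurable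
  have : (haar G).inv.IsHaarMeasure :=
    Measure.isHaarMeasure_of_isCompact_nonempty_interior _ Set.univ isCompact_univ
      (by simp) (by simp) (by simp)
  exact Measure.isHaarMeasure_eq_of_isProbabilityMeasure _ _

theorem inner_toL2 (f g : C(G, ℂ)) :
    ⟪toL2 G f, toL2 G g⟫_ℂ = ∫ x, g x * conj (f x) ∂haar G :=
  ContinuousMap.inner_toLp _ f g

theorem toL2_injective : Function.Injective (toL2 G) :=
  ContinuousMap.toLp_injective (haar G)

theorem denseRange_toL2 [T2Space G] : DenseRange (toL2 G) :=
  ContinuousMap.toLp_denseRange ℂ (haar G) ℂ (by norm_num)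

/-- The right translate `x ↦ f (x * σ)` of a continuous function. -/
def translate (σ : G) (f : C(G, ℂ)) : C(G, ℂ) := f.comp (ContinuousMap.mulRight σ)

@[simp]
theorem translate_apply (σ x : G) (f : C(G, ℂ)) : translate σ f x = f (x * σ) := rfl

theorem continuous_translate (f : C(G, ℂ)) : Continuous fun σ => translate σ f :=
  ContinuousMap.continuous_of_continuous_uncurry _
    (f.continuous.comp (continuous_snd.mul continuous_fst))

variable (G) in
/-- The right regular representation on `L²(G)`. -/
def rightRegular : Representation ℂ G (L2 G) where
  toFun σ := (Lp.compMeasurePreservingₗ ℂ (· * σ) (measurePreserving_mul_right (haar G) σ))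
  map_one' := by
    ext1 f
    have h : ∀ (φ : G → G) (hφ : MeasurePreserving φ (haar G) (haar G)), φ = id →
        Lp.compMeasurePreserving φ hφ f = f := by
      rintro _ hφ rfl
      exact Lp.compMeasurePreserving_id_apply f
    exact h _ _ (funext mul_one)
  map_mul' σ τ := by
    ext1 f
    have h : ∀ (φ : G → G) (hφ : MeasurePreserving φ (haar G) (haar G)),
        φ = (· * τ) ∘ (· * σ) → Lp.compMeasurePreserving φ hφ f =
          Lp.compMeasurePreserving _ (measurePreserving_mul_right (haar G) σ)
            (Lp.compMeasurePreserving _ (measurePreserving_mul_right (haar G) τ) f) := by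
      rintro _ hφ rfl
      exact Lp.compMeasurePreserving_comp_apply f (measurePreserving_mul_right (haar G) τ)
        (measurePreserving_mul_right (haar G) σ)
    exact h _ _ (funext fun x => (mul_assoc x σ τ).symm)

theorem rightRegular_toL2 (σ : G) (f : C(G, ℂ)) :
    rightRegular G σ (toL2 G f) = toL2 G (translate σ f) := rfl

theorem norm_rightRegular (σ : G) (f : L2 G) : ‖rightRegular G σ f‖ = ‖f‖ :=
  Lp.norm_compMeasurePreserving f (measurePreserving_mul_right (haar G) σ)

theorem inner_rightRegular (σ : G) (f g : L2 G) :
    ⟪rightRegular G σ f, rightRegular G σ g⟫_ℂ = ⟪f, g⟫_ℂ :=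
  LinearIsometry.inner_map_map ⟨rightRegular G σ, norm_rightRegular σ⟩ f g

end RightRegular

/-! ### Finite-dimensional unitary representations and complete reducibility. -/

section FiniteDimensional

variable {G : Type*} [Group G] [TopologicalSpace G]

@[simp]
theorem matrixRep_apply {d : ℕ} (ρ : G →* unitaryGroup (Fin d) ℂ) (σ : G) (v : Fin d → ℂ) :
    matrixRep ρ σ v = (ρ σ : Matrix (Fin d) (Fin d) ℂ) *ᵥ v := rfl

theorem UnitaryIrrep.coeff_apply (π : UnitaryIrrep G) (i j : Fin π.dim) (σ : G) :
    π.coeff i j σ = (π.hom σ : Matrix (Fin π.dim) (Fin π.dim) ℂ) i j := rfl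

variable (G) in
/-- The span of all matrix coefficients of continuous irreducible unitary representations. -/
def coeffSpan : Submodule ℂ C(G, ℂ) :=
  Submodule.span ℂ {f | ∃ (π : UnitaryIrrep G) (i j : Fin π.dim), f = π.coeff i j}

theorem coeff_mem_coeffSpan (π : UnitaryIrrep G) (i j : Fin π.dim) :
    π.coeff i j ∈ coeffSpan G :=
  Submodule.subset_span ⟨π, i, j, rfl⟩

variable {H : Type*} [NormedAddCommGroup H] [InnerProductSpace ℂ H] {R : Representation ℂ G H}

theorem exists_unitaryGroup_hom (hR : ∀ σ v w, ⟪R σ v, R σ w⟫_ℂ = ⟪v, w⟫_ℂ)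
    {E : Submodule ℂ H} [FiniteDimensional ℂ E] (hE : ∀ σ, ∀ v ∈ E, R σ v ∈ E) {n : ℕ}
    (b : OrthonormalBasis (Fin n) ℂ E) :
    ∃ u : G →* unitaryGroup (Fin n) ℂ,
      (∀ σ i j, (u σ : Matrix (Fin n) (Fin n) ℂ) i j = ⟪(b i : H), R σ (b j)⟫_ℂ) ∧
      ∀ σ (x : E), matrixRep u σ (b.toBasis.equivFun x) =
        b.toBasis.equivFun ⟨R σ x, hE σ x x.2⟩ := by
  let M : G → Matrix (Fin n) (Fin n) ℂ := fun σ =>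
    LinearMap.toMatrixOrthonormal b ((R σ).restrict (hE σ))
  -- One-sided unitarity suffices, because `E` is finite-dimensional.
  have hadj : ∀ σ, star ((R σ).restrict (hE σ)) * (R σ).restrict (hE σ) = 1 := by
    intro σ
    ext1 x
    refine ext_inner_left ℂ fun y => ?_
    rw [Module.End.mul_apply, LinearMap.star_eq_adjoint, LinearMap.adjoint_inner_right]
    exact hR σ y x
  have hM : ∀ σ, M σ ∈ unitaryGroup (Fin n) ℂ := fun σ => by
    rw [mem_unitaryGroup_iff', ← map_star, ← map_mul, hadj, map_one]
  refine ⟨⟨⟨fun σ => ⟨M σ, hM σ⟩, ?_⟩, ?_⟩, ?_, ?_⟩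
  · apply Subtype.ext
    change LinearMap.toMatrixOrthonormal b _ = 1
    rw [← map_one (LinearMap.toMatrixOrthonormal b)]
    congr 1
    ext1 x
    apply Subtype.ext
    simp
  · intro σ τ
    apply Subtype.ext
    change LinearMap.toMatrixOrthonormal b _ =
      LinearMap.toMatrixOrthonormal b _ * LinearMap.toMatrixOrthonormal b _
    rw [← map_mul]
    congr 1
    ext1 x
    apply Subtype.ext
    simp
  · intro σ i j
    exact LinearMap.toMatrixOrthonormal_apply_apply b _ i j
  · intro σ x
    rw [matrixRep_apply]
    exact LinearMap.toMatrix_mulVec_repr b.toBasis b.toBasis ((R σ).restrict (hE σ)) x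

theorem exists_unitaryIrrep (hR : ∀ σ v w, ⟪R σ v, R σ w⟫_ℂ = ⟪v, w⟫_ℂ)
    {E : Submodule ℂ H} [FiniteDimensional ℂ E] (hE : ∀ σ, ∀ v ∈ E, R σ v ∈ E)
    (hcont : ∀ v ∈ E, ∀ w ∈ E, Continuous fun σ => ⟪v, R σ w⟫_ℂ) (hbot : E ≠ ⊥)
    (hirr : ∀ F ≤ E, (∀ σ, ∀ v ∈ F, R σ v ∈ F) → F = ⊥ ∨ F = E) :
    ∃ (π : UnitaryIrrep G) (b : OrthonormalBasis (Fin π.dim) ℂ E),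
      ∀ σ i j, π.coeff i j σ = ⟪(b i : H), R σ (b j)⟫_ℂ := by
  let b := stdOrthonormalBasis ℂ E
  obtain ⟨u, hu, hint⟩ := exists_unitaryGroup_hom hR hE b
  have hcu : Continuous u := by
    refine continuous_induced_rng.2 (continuous_matrix fun i j => ?_)
    simp only [Function.comp_apply, hu]
    exact hcont _ (b i).2 _ (b j).2
  have : Nontrivial E := Submodule.nontrivial_iff_ne_bot.2 hbot
  have : Nontrivial (Fin (Module.finrank ℂ E) → ℂ) := b.toBasis.equivFun.injective.nontrivial
  have hsimple : (matrixRep u).IsIrreducible := by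
    refine { exists_pair_ne := ⟨⊥, ⊤, fun h => ?_⟩, eq_bot_or_eq_top := fun S => ?_ }
    · exact bot_ne_top (α := Submodule ℂ (Fin (Module.finrank ℂ E) → ℂ))
        (congrArg Subrepresentation.toSubmodule h)
    -- An invariant subspace of the coordinate model is carried back into `E`, where irreducibility
    -- is assumed.
    · have h1 := hirr ((S.toSubmodule.comap b.toBasis.equivFun.toLinearMap).map E.subtype)
        (Submodule.map_subtype_le _ _) (by
          rintro σ _ ⟨x, hx, rfl⟩
          refine ⟨⟨R σ x, hE σ x x.2⟩, ?_, rfl⟩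
          have := S.apply_mem_toSubmodule σ hx
          simp only [LinearEquiv.coe_coe, hint] at this
          exact this)
      rcases h1 with h1 | h1
      · left
        apply Subrepresentation.toSubmodule_injective
        rw [← Submodule.map_bot E.subtype] at h1
        replace h1 := Submodule.map_injective_of_injective E.injective_subtype h1
        refine (Submodule.eq_bot_iff _).2 fun x hx => ?_
        obtain ⟨y, rfl⟩ := b.toBasis.equivFun.surjective x
        have : y ∈ S.toSubmodule.comap b.toBasis.equivFun.toLinearMap := hx
        rw [h1, Submodule.mem_bot] at this
        rw [this, map_zero]
      · right
        apply Subrepresentation.toSubmodule_injective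
        refine (Submodule.eq_top_iff').2 fun x => ?_
        obtain ⟨y, rfl⟩ := b.toBasis.equivFun.surjective x
        have : (y : H) ∈ (S.toSubmodule.comap b.toBasis.equivFun.toLinearMap).map E.subtype := by
          rw [h1]; exact y.2
        obtain ⟨z, hz, hzy⟩ := this
        rw [← Subtype.ext hzy]
        exact hz
  exact ⟨⟨_, u, hcu, hsimple⟩, b, fun σ i j => hu σ i j⟩

/-- Matrix coefficients of a finite-dimensional continuous unitary representation are linear
combinations of matrix coefficients of irreducible ones. -/
theorem mem_coeffSpan_of_forall_eq_inner (hR : ∀ σ v w, ⟪R σ v, R σ w⟫_ℂ = ⟪v, w⟫_ℂ)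
    (E : Submodule ℂ H) [FiniteDimensional ℂ E] (hE : ∀ σ, ∀ v ∈ E, R σ v ∈ E)
    (hcont : ∀ v ∈ E, ∀ w ∈ E, Continuous fun σ => ⟪v, R σ w⟫_ℂ)
    {v w : H} (hv : v ∈ E) (hw : w ∈ E) (f : C(G, ℂ)) (hf : ∀ σ, f σ = ⟪v, R σ w⟫_ℂ) :
    f ∈ coeffSpan G := by
  -- Induction on dimension: if `E` is reducible it splits orthogonally as `F` and `E ⊓ Fᗮ`, both
  -- invariant, and the cross terms of the coefficient vanish.
  induction hn : Module.finrank ℂ E using Nat.strong_induction_on generalizing E v w f with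
  | _ n ih =>
  subst hn
  by_cases hbot : E = ⊥
  · have : f = 0 := by
      ext σ
      rw [hbot, Submodule.mem_bot] at hv
      simp [hf, hv]
    rw [this]
    exact zero_mem _
  by_cases hirr : ∀ F ≤ E, (∀ σ, ∀ v ∈ F, R σ v ∈ F) → F = ⊥ ∨ F = E
  · obtain ⟨π, b, hb⟩ := exists_unitaryIrrep hR hE hcont hbot hirr
    have hfe : f = ∑ i, ∑ j, (conj ⟪b i, (⟨v, hv⟩ : E)⟫_ℂ * ⟪b j, (⟨w, hw⟩ : E)⟫_ℂ) •
        π.coeff i j := by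
      ext σ
      have hv' : v = ∑ i, ⟪b i, (⟨v, hv⟩ : E)⟫_ℂ • (b i : H) := by
        have := congrArg E.subtype (b.sum_repr' ⟨v, hv⟩)
        simpa [map_sum] using this.symm
      have hw' : w = ∑ i, ⟪b i, (⟨w, hw⟩ : E)⟫_ℂ • (b i : H) := by
        have := congrArg E.subtype (b.sum_repr' ⟨w, hw⟩)
        simpa [map_sum] using this.symm
      rw [hf]
      conv_lhs => rw [hv', hw']
      simp only [map_sum, map_smul, sum_inner, inner_sum, inner_smul_left, inner_smul_right,
        ContinuousMap.sum_apply, ContinuousMap.smul_apply, hb, smul_eq_mul]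
      simp only [Finset.mul_sum]
      rw [Finset.sum_comm]
      exact Finset.sum_congr rfl fun i _ => Finset.sum_congr rfl fun j _ => by ring
    rw [hfe]
    exact Submodule.sum_mem _ fun i _ => Submodule.sum_mem _ fun j _ =>
      Submodule.smul_mem _ _ (coeff_mem_coeffSpan π i j)
  · push Not at hirr
    obtain ⟨F, hFE, hF, hF0, hF1⟩ := hirr
    have hFd : FiniteDimensional ℂ F := Submodule.finiteDimensional_of_le hFE
    have hperp : ∀ σ, ∀ x ∈ E ⊓ Fᗮ, R σ x ∈ E ⊓ Fᗮ := by
      intro σ x hx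
      refine ⟨hE σ x hx.1, fun y hy => ?_⟩
      have := hR σ (R σ⁻¹ y) x
      rw [← Module.End.mul_apply, ← map_mul, mul_inv_cancel, map_one, Module.End.one_apply] at this
      rw [this]
      exact hx.2 _ (hF _ _ hy)
    have hle : E ⊓ Fᗮ ≤ E := inf_le_left
    have hne : E ⊓ Fᗮ ≠ E := fun h => hF0 <| by
      refine (Submodule.eq_bot_iff _).2 fun x hx => ?_
      have h1 : x ∈ E ⊓ Fᗮ := by rw [h]; exact hFE hx
      exact inner_self_eq_zero.1 (h1.2 x hx)
    have hPd : FiniteDimensional ℂ ↥(E ⊓ Fᗮ) := Submodule.finiteDimensional_of_le hle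
    have split : ∀ x ∈ E, ∃ y ∈ F, ∃ z ∈ E ⊓ Fᗮ, x = y + z := fun x hx => by
      have hy := F.starProjection_apply_mem x
      refine ⟨F.starProjection x, hy, x - F.starProjection x,
        ⟨E.sub_mem hx (hFE hy), F.sub_starProjection_mem_orthogonal x⟩, by abel⟩
    obtain ⟨v₁, hv₁, v₂, hv₂, rfl⟩ := split v hv
    obtain ⟨w₁, hw₁, w₂, hw₂, rfl⟩ := split w hw
    let f₁ : C(G, ℂ) := ⟨fun σ => ⟪v₁, R σ w₁⟫_ℂ, hcont _ (hFE hv₁) _ (hFE hw₁)⟩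
    let f₂ : C(G, ℂ) := ⟨fun σ => ⟪v₂, R σ w₂⟫_ℂ, hcont _ (hle hv₂) _ (hle hw₂)⟩
    have h₁ : f₁ ∈ coeffSpan G := ih _ (Submodule.finrank_lt_finrank_of_lt (lt_of_le_of_ne hFE hF1))
      F hF (fun v hv w hw => hcont v (hFE hv) w (hFE hw)) hv₁ hw₁ f₁ (fun _ => rfl) rfl
    have h₂ : f₂ ∈ coeffSpan G := ih _ (Submodule.finrank_lt_finrank_of_lt (lt_of_le_of_ne hle hne))
      _ hperp (fun v hv w hw => hcont v (hle hv) w (hle hw)) hv₂ hw₂ f₂ (fun _ => rfl) rfl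
    have : f = f₁ + f₂ := by
      ext σ
      have e1 : ⟪v₁, R σ w₂⟫_ℂ = 0 := (hperp σ _ hw₂).2 _ hv₁
      have e2 : ⟪v₂, R σ w₁⟫_ℂ = 0 := Submodule.inner_left_of_mem_orthogonal (hF σ _ hw₁) hv₂.2
      rw [hf, map_add, inner_add_left, inner_add_right, inner_add_right, e1, e2, add_zero, zero_add]
      rfl
    rw [this]
    exact add_mem h₁ h₂

end FiniteDimensional

/-! ### Compactness of operators given by continuous families of vectors. -/

section InnerMap

variable {X : Type*} [TopologicalSpace X] [CompactSpace X] {H : Type*} [NormedAddCommGroup H]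
  [InnerProductSpace ℂ H]

/-- The operator `v ↦ (x ↦ ⟪φ x, v⟫)` defined by a continuous family of vectors. -/
def innerMap (φ : C(X, H)) : H →L[ℂ] C(X, ℂ) :=
  LinearMap.mkContinuous
    { toFun := fun v => ⟨fun x => ⟪φ x, v⟫_ℂ, φ.continuous.inner continuous_const⟩
      map_add' := fun v w => by ext x; exact inner_add_right _ _ _
      map_smul' := fun c v => by ext x; exact inner_smul_right _ _ _ }
    ‖φ‖ fun v => (ContinuousMap.norm_le _ (by positivity)).2 fun x =>
      (norm_inner_le_norm _ _).trans (by gcongr; exact φ.norm_coe_le_norm x)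

@[simp]
theorem innerMap_apply (φ : C(X, H)) (v : H) (x : X) : innerMap φ v x = ⟪φ x, v⟫_ℂ := rfl

/-- Arzelà–Ascoli: on the unit ball the functions are bounded by `‖φ‖`, and `‖φ x₀ - φ x‖` is a
modulus of continuity independent of `v`. -/
theorem isCompactOperator_innerMap (φ : C(X, H)) : IsCompactOperator (innerMap φ) := by
  let Φ := ContinuousMap.isometryEquivBoundedOfCompact X ℂ
  have hcpt : IsCompact (closure ((fun v => Φ (innerMap φ v)) '' Metric.ball 0 1)) := by
    refine BoundedContinuousFunction.arzela_ascoli (Metric.closedBall (0 : ℂ) ‖φ‖)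
      (isCompact_closedBall _ _) _ ?_ ?_
    · rintro _ x ⟨v, hv, rfl⟩
      rw [mem_closedBall_zero_iff]
      rw [mem_ball_zero_iff] at hv
      calc ‖⟪φ x, v⟫_ℂ‖ ≤ ‖φ x‖ * ‖v‖ := norm_inner_le_norm _ _
        _ ≤ ‖φ‖ * 1 := by gcongr; exact φ.norm_coe_le_norm x
        _ = ‖φ‖ := mul_one _
    · intro x₀
      refine Metric.equicontinuousAt_of_continuity_modulus (fun x => ‖φ x₀ - φ x‖) ?_ _ ?_
      · have : Continuous fun x => ‖φ x₀ - φ x‖ := by fun_prop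
        simpa using this.tendsto x₀
      · refine Filter.Eventually.of_forall fun x => ?_
        rintro ⟨_, v, hv, rfl⟩
        rw [mem_ball_zero_iff] at hv
        calc dist ⟪φ x₀, v⟫_ℂ ⟪φ x, v⟫_ℂ = ‖⟪φ x₀ - φ x, v⟫_ℂ‖ := by
              rw [dist_eq_norm, inner_sub_left]
          _ ≤ ‖φ x₀ - φ x‖ * ‖v‖ := norm_inner_le_norm _ _
          _ ≤ ‖φ x₀ - φ x‖ * 1 := by gcongr
          _ = ‖φ x₀ - φ x‖ := mul_one _
  have h : IsCompactOperator fun v => Φ (innerMap φ v) :=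
    (isCompactOperator_iff_exists_mem_nhds_image_subset_compact _).2
      ⟨_, Metric.ball_mem_nhds 0 one_pos, _, hcpt, subset_closure⟩
  have h2 := h.continuous_comp Φ.symm.continuous
  simpa [Function.comp_def] using h2

end InnerMap

/-! ### The Peter–Weyl theorem. -/

section PeterWeyl

variable {G : Type*} [Group G] [TopologicalSpace G] [IsTopologicalGroup G] [CompactSpace G]
  [MeasurableSpace G] [BorelSpace G]

/-- The operator on `L²(G)` defined by a continuous family of vectors in `L²(G)`. -/
def innerOp (φ : C(G, L2 G)) : L2 G →L[ℂ] L2 G := toL2 G ∘L innerMap φ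

theorem innerOp_apply (φ : C(G, L2 G)) (f : L2 G) : innerOp φ f = toL2 G (innerMap φ f) := rfl

theorem isCompactOperator_innerOp_comp (φ : C(G, L2 G)) (S : L2 G →L[ℂ] L2 G) :
    IsCompactOperator (innerOp φ ∘L S) :=
  IsCompactOperator.comp_clm (f := innerOp φ)
    ((isCompactOperator_innerMap φ).continuous_comp (toL2 G).continuous) S

/-- The family `φ` is equivariant under right translations. -/
def IsEquivariant (φ : C(G, L2 G)) : Prop :=
  ∀ σ x, rightRegular G σ (φ (x * σ)) = φ x

theorem innerMap_rightRegular {φ : C(G, L2 G)} (hφ : IsEquivariant φ) (σ : G) (f : L2 G) :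
    innerMap φ (rightRegular G σ f) = translate σ (innerMap φ f) := by
  ext x
  rw [innerMap_apply, ← hφ σ x, inner_rightRegular]
  rfl

theorem innerOp_rightRegular {φ : C(G, L2 G)} (hφ : IsEquivariant φ) (σ : G) (f : L2 G) :
    innerOp φ (rightRegular G σ f) = rightRegular G σ (innerOp φ f) := by
  rw [innerOp_apply, innerOp_apply, innerMap_rightRegular hφ, rightRegular_toL2]

theorem rightRegular_inv_apply (σ : G) (f : L2 G) :
    rightRegular G σ (rightRegular G σ⁻¹ f) = f := by
  rw [← Module.End.mul_apply, ← map_mul, mul_inv_cancel, map_one, Module.End.one_apply]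

theorem adjoint_innerOp_rightRegular {φ : C(G, L2 G)} (hφ : IsEquivariant φ) (σ : G) (f : L2 G) :
    (innerOp φ).adjoint (rightRegular G σ f) = rightRegular G σ ((innerOp φ).adjoint f) := by
  refine ext_inner_right ℂ fun g => ?_
  rw [ContinuousLinearMap.adjoint_inner_left, ← rightRegular_inv_apply σ g,
    innerOp_rightRegular hφ, inner_rightRegular, inner_rightRegular,
    ContinuousLinearMap.adjoint_inner_left]

/-- The eigenspace is finite-dimensional by compactness and right-invariant by equivariance. As `z ≠
0`, each eigenvector is in the range of `innerOp φ` and so has a continuous representative, whose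
value at `σ` is the value at `1` of its right translate. -/
theorem mem_map_coeffSpan_of_eigenvector {φ : C(G, L2 G)} (hφ : IsEquivariant φ) {z : ℂ}
    (hz : z ≠ 0) {e : L2 G}
    (he : innerOp φ ((innerOp φ).adjoint e) = z • e) :
    e ∈ (coeffSpan G).map (toL2 G).toLinearMap := by
  let B : L2 G →L[ℂ] L2 G := innerOp φ ∘L (innerOp φ).adjoint
  have hBc : IsCompactOperator B := isCompactOperator_innerOp_comp φ _
  let E := Module.End.eigenspace (B : Module.End ℂ (L2 G)) z
  have hEd : FiniteDimensional ℂ E :=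
    ContinuousLinearMap.finite_dimensional_eigenspace hBc z hz
  have hmem : ∀ f, f ∈ E ↔ innerOp φ ((innerOp φ).adjoint f) = z • f := fun f =>
    Module.End.mem_eigenspace_iff
  have hinv : ∀ σ, ∀ f ∈ E, rightRegular G σ f ∈ E := by
    intro σ f hf
    rw [hmem] at hf ⊢
    rw [adjoint_innerOp_rightRegular hφ, innerOp_rightRegular hφ, hf, map_smul]
  -- the continuous representative of an element of `E`
  let cr : L2 G →L[ℂ] C(G, ℂ) := z⁻¹ • (innerMap φ ∘L (innerOp φ).adjoint)
  have hcr : ∀ f ∈ E, toL2 G (cr f) = f := by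
    intro f hf
    change toL2 G (z⁻¹ • innerMap φ ((innerOp φ).adjoint f)) = f
    rw [map_smul, ← innerOp_apply, (hmem f).1 hf, smul_smul, inv_mul_cancel₀ hz, one_smul]
  have hcrR : ∀ σ, ∀ f ∈ E, cr (rightRegular G σ f) = translate σ (cr f) := by
    intro σ f hf
    apply toL2_injective
    rw [hcr _ (hinv σ f hf), ← rightRegular_toL2, hcr f hf]
  have hcont : ∀ v ∈ E, ∀ w ∈ E, Continuous fun σ => ⟪v, rightRegular G σ w⟫_ℂ := by
    intro v _ w hw
    have : ∀ σ, rightRegular G σ w = toL2 G (translate σ (cr w)) := fun σ => by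
      rw [← rightRegular_toL2, hcr w hw]
    simp only [this]
    exact continuous_const.inner ((toL2 G).continuous.comp (continuous_translate _))
  -- By Riesz, evaluation at `1` is pairing with `v`, so `e(σ) = ⟪v, R_σ e⟫`. Projecting `v` to `E`
  -- does not change this pairing on `E`.
  let ℓ : L2 G →L[ℂ] ℂ := ContinuousMap.evalCLM ℂ (1 : G) ∘L cr
  let v := (InnerProductSpace.toDual ℂ (L2 G)).symm ℓ
  have hv : ∀ f, ⟪v, f⟫_ℂ = cr f 1 := fun f => InnerProductSpace.toDual_symm_apply
  have heE : e ∈ E := (hmem e).2 he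
  refine ⟨cr e, ?_, hcr e heE⟩
  refine mem_coeffSpan_of_forall_eq_inner (R := rightRegular G) inner_rightRegular E hinv hcont
    (E.starProjection_apply_mem v) heE _ fun σ => ?_
  rw [Submodule.inner_starProjection_left_eq_right,
    Submodule.starProjection_eq_self_iff.2 (hinv σ e heE), hv, hcrR σ e heE]
  simp

/-- With `A = innerOp φ`, the spectral theorem for the compact operator `A A*` gives `A A* g = 0`:
eigenvectors for nonzero eigenvalues are coefficients, hence orthogonal to `g`. Then `‖A* g‖² = ⟪g,
A A* g⟫ = 0`. -/
theorem inner_innerOp_eq_zero {φ : C(G, L2 G)} (hφ : IsEquivariant φ) {g : L2 G}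
    (hg : g ∈ ((coeffSpan G).map (toL2 G).toLinearMap)ᗮ) (f : L2 G) :
    ⟪g, innerOp φ f⟫_ℂ = 0 := by
  let B : L2 G →L[ℂ] L2 G := innerOp φ ∘L (innerOp φ).adjoint
  have hBc : IsCompactOperator B := isCompactOperator_innerOp_comp φ _
  have hsymm : (B : L2 G →ₗ[ℂ] L2 G).IsSymmetric := fun f g => by
    rw [ContinuousLinearMap.coe_coe, ContinuousLinearMap.comp_apply,
      ContinuousLinearMap.comp_apply, ← ContinuousLinearMap.adjoint_inner_right,
      ContinuousLinearMap.adjoint_inner_left]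
  have hBg : B g = 0 := by
    have h := ContinuousLinearMap.orthogonalComplement_iSup_eigenspaces_eq_bot hBc hsymm
    rw [← Submodule.mem_bot ℂ, ← h, Submodule.mem_orthogonal]
    intro e he
    refine Submodule.iSup_induction _ (motive := fun e => ⟪e, B g⟫_ℂ = 0) he ?_ (by simp) ?_
    · intro z e he
      have he' : B e = z • e := Module.End.mem_eigenspace_iff.1 he
      have h1 : ⟪e, B g⟫_ℂ = conj z * ⟪e, g⟫_ℂ := by
        rw [← inner_smul_left, ← he']
        exact (hsymm e g).symm
      by_cases hz : z = 0
      · rw [h1, hz, map_zero, zero_mul]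
      · rw [h1, hg e (mem_map_coeffSpan_of_eigenvector hφ hz he'), mul_zero]
    · intro x y hx hy
      rw [inner_add_left, hx, hy, add_zero]
  have hAg : (innerOp φ).adjoint g = 0 := by
    rw [← inner_self_eq_zero (𝕜 := ℂ), ContinuousLinearMap.adjoint_inner_left]
    change ⟪g, B g⟫_ℂ = 0
    rw [hBg, inner_zero_right]
  rw [← ContinuousLinearMap.adjoint_inner_left, hAg, inner_zero_left]

/-- The function `y ↦ conj (h (x * y⁻¹))`. -/
def convKernel (h : C(G, ℂ)) (x : G) : C(G, ℂ) :=
  ⟨fun y => conj (h (x * y⁻¹)), Complex.continuous_conj.comp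
    (h.continuous.comp (continuous_const.mul continuous_inv))⟩

/-- The family in `L²(G)` whose operator is convolution with `h` from the left. -/
def convFamily (h : C(G, ℂ)) : C(G, L2 G) where
  toFun x := toL2 G (convKernel h x)
  continuous_toFun := (toL2 G).continuous.comp <|
    ContinuousMap.continuous_of_continuous_uncurry _ <| Complex.continuous_conj.comp
      (h.continuous.comp (continuous_fst.mul continuous_snd.inv))

theorem isEquivariant_convFamily (h : C(G, ℂ)) : IsEquivariant (convFamily h) := by
  intro σ x
  change rightRegular G σ (toL2 G _) = toL2 G _
  rw [rightRegular_toL2]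
  congr 1
  ext y
  simp [convKernel, mul_assoc]

/-- The left translate `x ↦ f (y⁻¹ * x)`. -/
def leftTranslate (f : C(G, ℂ)) (y : G) : C(G, ℂ) := f.comp (ContinuousMap.mulLeft y⁻¹)

theorem continuous_leftTranslate (f : C(G, ℂ)) : Continuous (leftTranslate f) :=
  ContinuousMap.continuous_of_continuous_uncurry _
    (f.continuous.comp (continuous_fst.inv.mul continuous_snd))

/-- The substitutions `y ↦ y * x` and `y ↦ y⁻¹` turn the pairing into an average of left translates.
It is stated as an integral in `C(G, ℂ)` so that a continuous functional can be moved inside. -/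
theorem innerMap_convFamily (h f : C(G, ℂ)) :
    innerMap (convFamily h) (toL2 G f) = ∫ y, h y • leftTranslate f y ∂haar G := by
  have hint : Integrable (fun y => h y • leftTranslate f y) (haar G) :=
    integrable_of_continuous _ (h.continuous.smul (continuous_leftTranslate f))
  ext x
  have h1 : (∫ y, h y • leftTranslate f y ∂haar G) x =
      ∫ y, h y * f (y⁻¹ * x) ∂haar G :=
    ((ContinuousMap.evalCLM ℂ x).integral_comp_comm hint).symm
  rw [h1]
  change ⟪toL2 G (convKernel h x), toL2 G f⟫_ℂ = _
  rw [inner_toL2, ← integral_mul_right_eq_self _ x, ← integral_inv_eq_self]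
  refine integral_congr_ae (Filter.Eventually.of_forall fun y => ?_)
  simp [convKernel, mul_comm]

theorem eq_zero_of_integral_conj_mul_self {F : C(G, ℂ)}
    (hF : ∫ y, conj (F y) * F y ∂haar G = 0) : F = 0 := by
  apply toL2_injective
  rw [map_zero, ← inner_self_eq_zero (𝕜 := ℂ), inner_toL2, ← hF]
  simp only [mul_comm]

/-- **Peter–Weyl theorem**: the matrix coefficients span a dense subspace of `L²(G)`. -/
theorem orthogonal_map_coeffSpan [T2Space G] :
    ((coeffSpan G).map (toL2 G).toLinearMap)ᗮ = ⊥ := by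
  refine (Submodule.eq_bot_iff _).2 fun g hg => ?_
  have key : ∀ f : C(G, ℂ), ⟪g, toL2 G f⟫_ℂ = 0 := by
    intro f
    -- With kernel `star F`, the vanishing of `⟪g, A f⟫` reads `∫ |F|² = 0`. Hence `F = 0`, and its
    -- value at `1` is `⟪g, f⟫`.
    let F : C(G, ℂ) := ⟨fun y => ⟪g, toL2 G (leftTranslate f y)⟫_ℂ,
      continuous_const.inner ((toL2 G).continuous.comp (continuous_leftTranslate f))⟩
    have hF : F = 0 := by
      apply eq_zero_of_integral_conj_mul_self
      have h0 := inner_innerOp_eq_zero (isEquivariant_convFamily (star F)) hg (toL2 G f)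
      have hint : Integrable (fun y => star F y • leftTranslate f y) (haar G) :=
        integrable_of_continuous _ ((star F).continuous.smul (continuous_leftTranslate f))
      rw [innerOp_apply, innerMap_convFamily] at h0
      have h1 := (innerSL ℂ g ∘L toL2 G).integral_comp_comm hint
      simp only [ContinuousLinearMap.comp_apply, innerSL_apply_apply] at h1
      rw [h0] at h1
      rw [← h1]
      refine integral_congr_ae (Filter.Eventually.of_forall fun y => ?_)
      simp [F, inner_smul_right]
    have h1 : F 1 = 0 := by rw [hF]; rfl
    have h2 : leftTranslate f 1 = f := by ext x; simp [leftTranslate]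
    rw [← h1, ← h2]
    simp [F, h2]
  exact denseRange_toL2.eq_zero_of_inner_left ℂ key

end PeterWeyl

/-! ### Schur's lemma and the orthogonality relations. -/

section Schur

variable {G : Type*} [Group G] [TopologicalSpace G]

namespace UnitaryIrrep

theorem dim_pos (π : UnitaryIrrep G) : 0 < π.dim := by
  by_contra h
  have : IsEmpty (Fin π.dim) := by
    rw [Nat.pos_iff_ne_zero, not_not] at h
    rw [h]
    infer_instance
  obtain ⟨S, T, hST⟩ := π.irreducible.exists_pair_ne
  exact hST (Subrepresentation.toSubmodule_injective (Subsingleton.elim _ _))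

/-- The intertwining map given by an intertwining matrix. -/
def intertwiningMap {π ρ : UnitaryIrrep G} (X : Matrix (Fin ρ.dim) (Fin π.dim) ℂ)
    (hX : ∀ σ, X * (π.hom σ).1 = (ρ.hom σ).1 * X) :
    Representation.IntertwiningMap (matrixRep π.hom) (matrixRep ρ.hom) where
  __ := Matrix.toLin' X
  isIntertwining' σ := by
    refine LinearMap.ext fun v => ?_
    simp only [LinearMap.comp_apply, Matrix.toLin'_apply, matrixRep_apply, mulVec_mulVec, hX]

theorem eq_zero_of_intertwines {π ρ : UnitaryIrrep G} (h : ¬ π ≈ ρ)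
    (X : Matrix (Fin ρ.dim) (Fin π.dim) ℂ)
    (hX : ∀ σ, X * (π.hom σ).1 = (ρ.hom σ).1 * X) : X = 0 := by
  have := π.irreducible
  have := ρ.irreducible
  have : IsEmpty ((matrixRep π.hom).Equiv (matrixRep ρ.hom)) := not_nonempty_iff.1 h
  have h0 : intertwiningMap X hX = 0 := Subsingleton.elim _ _
  apply Matrix.toLin'.injective
  rw [map_zero]
  exact congrArg Representation.IntertwiningMap.toLinearMap h0

theorem exists_eq_smul_one_of_commute {π : UnitaryIrrep G}
    (X : Matrix (Fin π.dim) (Fin π.dim) ℂ)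
    (hX : ∀ σ, X * (π.hom σ).1 = (π.hom σ).1 * X) : ∃ c : ℂ, X = c • 1 := by
  have := π.irreducible
  obtain ⟨c, hc⟩ := (Representation.IsIrreducible.algebraMap_intertwiningMap_bijective_of_isAlgClosed
    (k := ℂ) (ρ := matrixRep π.hom)).2 (intertwiningMap X hX)
  refine ⟨c, ?_⟩
  apply Matrix.toLin'.injective
  rw [Representation.IntertwiningMap.algebraMap_apply] at hc
  have h := congrArg Representation.IntertwiningMap.toLinearMap hc
  rw [map_smul, Matrix.toLin'_one]
  exact h.symm

theorem exists_matrix_of_equiv {π ρ : UnitaryIrrep G} (h : π ≈ ρ) :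
    ∃ (A : Matrix (Fin ρ.dim) (Fin π.dim) ℂ) (B : Matrix (Fin π.dim) (Fin ρ.dim) ℂ),
      B * A = 1 ∧ ∀ σ, (π.hom σ).1 = B * (ρ.hom σ).1 * A := by
  obtain ⟨e⟩ := h
  have hBA : LinearMap.toMatrix' e.toLinearEquiv.symm.toLinearMap *
      LinearMap.toMatrix' e.toLinearEquiv.toLinearMap = 1 := by
    rw [← LinearMap.toMatrix'_comp, LinearEquiv.comp_coe, LinearEquiv.self_trans_symm]
    exact LinearMap.toMatrix'_id
  refine ⟨LinearMap.toMatrix' e.toLinearEquiv.toLinearMap,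
    LinearMap.toMatrix' e.toLinearEquiv.symm.toLinearMap, hBA, fun σ => ?_⟩
  have hA : (ρ.hom σ).1 * LinearMap.toMatrix' e.toLinearEquiv.toLinearMap =
      LinearMap.toMatrix' e.toLinearEquiv.toLinearMap * (π.hom σ).1 := by
    apply Matrix.toLin'.injective
    refine LinearMap.ext fun v => ?_
    have := e.toIntertwiningMap.isIntertwining _ _ σ v
    simp only [Matrix.toLin'_mul, Matrix.toLin'_toMatrix', LinearMap.comp_apply]
    exact this.symm
  rw [Matrix.mul_assoc, hA, ← Matrix.mul_assoc, hBA, Matrix.one_mul]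

theorem coeff_mem_span_of_equiv {π ρ : UnitaryIrrep G} (h : π ≈ ρ) (i j : Fin π.dim) :
    π.coeff i j ∈ Submodule.span ℂ (Set.range fun a : Fin ρ.dim × Fin ρ.dim => ρ.coeff a.1 a.2) := by
  obtain ⟨A, B, -, hAB⟩ := exists_matrix_of_equiv h
  have : π.coeff i j = ∑ l, ∑ k, (B i k * A l j) • ρ.coeff k l := by
    ext σ
    simp only [coeff_apply, hAB, Matrix.mul_apply, ContinuousMap.sum_apply,
      ContinuousMap.smul_apply, smul_eq_mul, Finset.sum_mul]
    exact Finset.sum_congr rfl fun l _ => Finset.sum_congr rfl fun k _ => by ring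
  rw [this]
  exact Submodule.sum_mem _ fun l _ => Submodule.sum_mem _ fun k _ =>
    Submodule.smul_mem _ _ (Submodule.subset_span ⟨(k, l), rfl⟩)

theorem hom_inv_apply (π : UnitaryIrrep G) (σ : G) (i j : Fin π.dim) :
    (π.hom σ⁻¹).1 i j = conj ((π.hom σ).1 j i) := by
  rw [map_inv]
  rfl

theorem coeff_inv (π : UnitaryIrrep G) (σ : G) (i j : Fin π.dim) :
    π.coeff i j σ⁻¹ = conj (π.coeff j i σ) := hom_inv_apply π σ i j

theorem coeff_mul (π : UnitaryIrrep G) (σ τ : G) (i j : Fin π.dim) :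
    π.coeff i j (σ * τ) = ∑ k, π.coeff i k σ * π.coeff k j τ := by
  simp only [coeff_apply, map_mul]
  rfl

theorem coeff_one (π : UnitaryIrrep G) (i j : Fin π.dim) :
    π.coeff i j 1 = if i = j then 1 else 0 := by
  simp only [coeff_apply, map_one]
  rfl

variable [IsTopologicalGroup G] [CompactSpace G] [MeasurableSpace G] [BorelSpace G]

theorem translate_coeff (π : UnitaryIrrep G) (τ : G) (i j : Fin π.dim) :
    translate τ (π.coeff i j) = ∑ k, π.coeff k j τ • π.coeff i k := by
  ext σ
  simp [coeff_mul, mul_comm]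

/-- Right invariance moves `τ` from one argument of the inner product to the other; translation acts
on the column index only, so the rows `k` and `l` stay fixed. -/
theorem inner_coeff_intertwines (π ρ : UnitaryIrrep G) (k : Fin ρ.dim) (l : Fin π.dim) (τ : G) :
    (Matrix.of fun i j => ⟪toL2 G (ρ.coeff k i), toL2 G (π.coeff l j)⟫_ℂ) * (π.hom τ).1 =
      (ρ.hom τ).1 * Matrix.of fun i j => ⟪toL2 G (ρ.coeff k i), toL2 G (π.coeff l j)⟫_ℂ := by
  ext i j
  have h := inner_rightRegular τ (rightRegular G τ⁻¹ (toL2 G (ρ.coeff k i))) (toL2 G (π.coeff l j))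
  rw [rightRegular_inv_apply] at h
  simp only [rightRegular_toL2, translate_coeff, map_sum, map_smul, sum_inner, inner_sum,
    inner_smul_left, inner_smul_right, coeff_inv, Complex.conj_conj] at h
  simp only [Matrix.mul_apply, Matrix.of_apply]
  rw [← show _ = ∑ m, (ρ.hom τ).1 i m * ⟪toL2 G (ρ.coeff k m), toL2 G (π.coeff l j)⟫_ℂ from h]
  exact Finset.sum_congr rfl fun m _ => mul_comm _ _

theorem inner_coeff_of_not_equiv {π ρ : UnitaryIrrep G} (h : ¬ π ≈ ρ) (k i : Fin ρ.dim)
    (l j : Fin π.dim) : ⟪toL2 G (ρ.coeff k i), toL2 G (π.coeff l j)⟫_ℂ = 0 :=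
  congrFun (congrFun (eq_zero_of_intertwines h _ (inner_coeff_intertwines π ρ k l)) i) j

/-- The substitution `σ ↦ σ⁻¹` exchanges rows and columns, which transfers to row indices what
Schur's lemma gives for column indices. -/
theorem inner_coeff_comm (π : UnitaryIrrep G) (k i l j : Fin π.dim) :
    ⟪toL2 G (π.coeff k i), toL2 G (π.coeff l j)⟫_ℂ =
      ⟪toL2 G (π.coeff j l), toL2 G (π.coeff i k)⟫_ℂ := by
  rw [inner_toL2, inner_toL2, ← integral_inv_eq_self]
  simp only [coeff_inv, Complex.conj_conj, mul_comm]

theorem sum_inner_coeff_self (π : UnitaryIrrep G) (i : Fin π.dim) :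
    ∑ k, ⟪toL2 G (π.coeff k i), toL2 G (π.coeff k i)⟫_ℂ = 1 := by
  simp only [inner_toL2]
  rw [← integral_finsetSum]
  · have : ∀ x, ∑ k, π.coeff k i x * conj (π.coeff k i x) = 1 := fun x => by
      have := coeff_mul π x⁻¹ x i i
      rw [inv_mul_cancel, coeff_one, if_pos rfl] at this
      simp only [this, coeff_inv, mul_comm]
    simp [this]
  · intro k _
    exact integrable_of_continuous _ ((π.coeff k i).continuous.mul
      (Complex.continuous_conj.comp (π.coeff k i).continuous))

/-- **Schur orthogonality relations**. -/
theorem inner_coeff (π : UnitaryIrrep G) (k i l j : Fin π.dim) :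
    ⟪toL2 G (π.coeff k i), toL2 G (π.coeff l j)⟫_ℂ =
      if k = l ∧ i = j then (π.dim : ℂ)⁻¹ else 0 := by
  have hc : ∀ k l, ∃ c : ℂ, ∀ i j, ⟪toL2 G (π.coeff k i), toL2 G (π.coeff l j)⟫_ℂ =
      if i = j then c else 0 := by
    intro k l
    obtain ⟨c, hc⟩ := exists_eq_smul_one_of_commute _ (inner_coeff_intertwines π π k l)
    refine ⟨c, fun i j => ?_⟩
    have := congrFun (congrFun hc i) j
    simpa [Matrix.one_apply] using this
  choose c hc using hc
  -- The scalar depends on the rows alone by Schur's lemma; exchanging rows and columns shows that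
  -- it vanishes off the diagonal and is constant on it.
  have h1 : ∀ k l i, c k l = if l = k then c i i else 0 := fun k l i => by
    have := inner_coeff_comm π k i l i
    rwa [hc, hc, if_pos rfl] at this
  have h2 : ∀ k, c k k = (π.dim : ℂ)⁻¹ := fun k => by
    have := sum_inner_coeff_self π k
    simp only [hc, if_true] at this
    have h3 : ∀ m, c m m = c k k := fun m => by rw [h1 m m k, if_pos rfl]
    simp only [h3, Finset.sum_const, Finset.card_univ, Fintype.card_fin, nsmul_eq_mul] at this
    exact eq_inv_of_mul_eq_one_right this
  rw [hc, h1 k l k, h2]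
  grind

end UnitaryIrrep

end Schur

/-! ### Continuous one-parameter semigroups of real numbers. -/

section Exponential

theorem exists_mul_of_continuous_additive {L : ℝ≥0 → ℝ} (hL : Continuous L)
    (hadd : ∀ s t, L (s + t) = L s + L t) : ∃ a : ℝ, ∀ t : ℝ≥0, L t = t * a := by
  have h0 : L 0 = 0 := by simpa using hadd 0 0
  have hpm : ∀ x : ℝ, ((x.toNNReal : ℝ≥0) : ℝ) - ((-x).toNNReal : ℝ≥0) = x := fun x => by
    rw [Real.coe_toNNReal', Real.coe_toNNReal']
    exact max_zero_sub_max_neg_zero_eq_self x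
  -- Extension of `L` to the whole line by `L x⁺ - L x⁻`, where continuous additive maps are known
  -- to be linear.
  let f : ℝ →+ ℝ := AddMonoidHom.mk' (fun x => L x.toNNReal - L (-x).toNNReal) fun x y => by
    have h : (x + y).toNNReal + ((-x).toNNReal + (-y).toNNReal) =
        (-(x + y)).toNNReal + (x.toNNReal + y.toNNReal) := by
      apply NNReal.eq
      push_cast
      linarith [hpm x, hpm y, hpm (x + y)]
    have h' := congrArg L h
    simp only [hadd] at h'
    linarith
  have hf : Continuous f :=
    (hL.comp continuous_real_toNNReal).sub
      (hL.comp (continuous_real_toNNReal.comp continuous_neg))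
  have hfL : ∀ t : ℝ≥0, f t = L t := fun t => by
    have : (-(t : ℝ)).toNNReal = 0 := Real.toNNReal_of_nonpos (by simp)
    simp [f, this, h0]
  refine ⟨f 1, fun t => ?_⟩
  have := map_real_smul f hf (t : ℝ) 1
  rw [smul_eq_mul, mul_one, smul_eq_mul, hfL] at this
  exact this

theorem exists_exp_of_continuous_multiplicative {c : ℝ≥0 → ℝ} (hc : Continuous c)
    (h0 : c 0 = 1) (hmul : ∀ s t, c (s + t) = c s * c t) (hle : ∀ t, c t ≤ 1) :
    ∃ a ≤ 0, ∀ t : ℝ≥0, c t = Real.exp (t * a) := by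
  have hhalf : ∀ t, c t = c (t / 2) * c (t / 2) := fun t => by rw [← hmul, add_halves]
  have hpos : ∀ t, 0 < c t := by
    intro t
    refine lt_of_le_of_ne (by rw [hhalf]; exact mul_self_nonneg _) fun ht => ?_
    -- A zero at `t` would propagate to `t / 2 ^ n`, contradicting continuity at `0`, where the
    -- value is `1`.
    have hn : ∀ n : ℕ, c (t / 2 ^ n) = 0 := by
      intro n
      induction n with
      | zero => simpa using ht.symm
      | succ n ih =>
        rw [hhalf, div_div, ← pow_succ] at ih
        exact mul_self_eq_zero.1 ih
    have hlim : Filter.Tendsto (fun n : ℕ => t / 2 ^ n) Filter.atTop (nhds 0) :=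
      NNReal.tendsto_coe.1 <| by
        simpa [div_eq_mul_inv] using
          (tendsto_pow_atTop_nhds_zero_of_lt_one (r := (2⁻¹ : ℝ)) (by norm_num)
            (by norm_num)).const_mul (t : ℝ)
    have h1 := (hc.tendsto 0).comp hlim
    simp only [Function.comp_def, hn, h0] at h1
    exact zero_ne_one (tendsto_nhds_unique tendsto_const_nhds h1)
  obtain ⟨a, ha⟩ := exists_mul_of_continuous_additive (L := fun t => Real.log (c t))
    (hc.log fun t => (hpos t).ne') fun s t => by
      rw [hmul, Real.log_mul (hpos s).ne' (hpos t).ne']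
  refine ⟨a, ?_, fun t => by rw [← ha, Real.exp_log (hpos t)]⟩
  have := ha 1
  rw [NNReal.coe_one, one_mul] at this
  rw [← this]
  exact Real.log_nonpos (hpos 1).le (hle 1)

end Exponential

/-! ### Fourier transforms of central symmetric measures, and eigenvectors of the Hunt operator. -/

section Fourier

variable {G : Type*} [Group G] [TopologicalSpace G] [IsTopologicalGroup G] [CompactSpace G]
  [MeasurableSpace G] [BorelSpace G]

theorem measureFourier_apply (μ : Measure G) (π : UnitaryIrrep G) (i j : Fin π.dim) :
    measureFourier μ π i j = ∫ σ, π.coeff i j σ ∂μ := rfl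

/-- Linearity of the integral, with factors on both sides so that it serves for conjugation,
convolution, change of representative and the eigenvalue equation. -/
theorem mul_measureFourier_mul_apply (μ : Measure G) [IsFiniteMeasure μ] (π : UnitaryIrrep G)
    {m n : Type*} (P : Matrix m (Fin π.dim) ℂ) (Q : Matrix (Fin π.dim) n ℂ) (i : m) (j : n) :
    (P * measureFourier μ π * Q) i j = ∫ σ, (P * (π.hom σ).1 * Q) i j ∂μ := by
  have hint : ∀ k l, Integrable (π.coeff k l) μ := fun k l =>
    integrable_of_continuous _ (π.coeff k l).continuous
  have h : ∀ σ, (P * (π.hom σ).1 * Q) i j = ∑ l, ∑ k, P i k * Q l j * π.coeff k l σ := fun σ => by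
    simp only [Matrix.mul_apply, Finset.sum_mul]
    exact Finset.sum_congr rfl fun l _ => Finset.sum_congr rfl fun k _ => mul_right_comm _ _ _
  simp only [h]
  rw [integral_finsetSum _ fun l _ => integrable_finsetSum _ fun k _ => (hint k l).const_mul _]
  simp only [Matrix.mul_apply, Finset.sum_mul]
  refine Finset.sum_congr rfl fun l _ => ?_
  rw [integral_finsetSum _ fun k _ => (hint k l).const_mul _]
  refine Finset.sum_congr rfl fun k _ => ?_
  rw [integral_const_mul, measureFourier_apply, mul_right_comm]

theorem measureFourier_commute {μ : Measure G} [IsFiniteMeasure μ] (hμ : IsCentral μ)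
    (π : UnitaryIrrep G) (σ : G) :
    measureFourier μ π * (π.hom σ).1 = (π.hom σ).1 * measureFourier μ π := by
  let φ : G ≃ₜ G := (Homeomorph.mulLeft σ).trans (Homeomorph.mulRight σ⁻¹)
  have hφ : ∀ x, φ x = σ * x * σ⁻¹ := fun x => rfl
  have hmap : Measure.map φ μ = μ := by
    ext A hA
    rw [φ.measurableEmbedding.map_apply, ← hμ σ _ (φ.continuous.measurable hA)]
    congr 1
    exact Set.image_preimage_eq A φ.surjective
  have hinv : (π.hom σ⁻¹).1 * (π.hom σ).1 = 1 := by
    rw [← Submonoid.coe_mul, ← map_mul, inv_mul_cancel, map_one]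
    rfl
  have h : (π.hom σ).1 * measureFourier μ π * (π.hom σ⁻¹).1 = measureFourier μ π := by
    ext i j
    rw [mul_measureFourier_mul_apply, measureFourier_apply]
    conv_rhs => rw [← hmap, φ.measurableEmbedding.integral_map]
    simp only [hφ, UnitaryIrrep.coeff_apply, map_mul, Submonoid.coe_mul]
  nth_rewrite 1 [← h]
  rw [mul_assoc, hinv, mul_one]

theorem conjTranspose_measureFourier {μ : Measure G} (hμ : IsSymmetric μ) (π : UnitaryIrrep G) :
    (measureFourier μ π)ᴴ = measureFourier μ π := by
  have hmap : Measure.map (Homeomorph.inv G) μ = μ := by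
    ext A hA
    rw [(Homeomorph.inv G).measurableEmbedding.map_apply]
    exact hμ A hA
  ext i j
  rw [conjTranspose_apply, measureFourier_apply, measureFourier_apply]
  conv_rhs => rw [← hmap, (Homeomorph.inv G).measurableEmbedding.integral_map]
  simp only [Homeomorph.coe_inv, UnitaryIrrep.coeff_inv]
  exact integral_conj.symm

theorem exists_real_measureFourier {μ : Measure G} [IsFiniteMeasure μ] (hμ : IsCentral μ)
    (hsymm : IsSymmetric μ) (π : UnitaryIrrep G) :
    ∃ c : ℝ, measureFourier μ π = (c : ℂ) • 1 := by
  obtain ⟨c, hc⟩ := UnitaryIrrep.exists_eq_smul_one_of_commute _ (measureFourier_commute hμ π)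
  refine ⟨c.re, ?_⟩
  have h := conjTranspose_measureFourier hsymm π
  have h1 := congrFun (congrFun h ⟨0, π.dim_pos⟩) ⟨0, π.dim_pos⟩
  rw [hc] at h1 ⊢
  rw [Complex.conj_eq_iff_re.1]
  simpa using h1

theorem measureFourier_add {μ : ℝ≥0 → ProbabilityMeasure G} (hμ : IsConvolutionSemigroup μ)
    (π : UnitaryIrrep G) (s t : ℝ≥0) :
    measureFourier (μ (s + t) : Measure G) π =
      measureFourier (μ s : Measure G) π * measureFourier (μ t : Measure G) π := by
  ext i j
  -- Identity factors are inserted to fit the two-sided form of `mul_measureFourier_mul_apply`.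
  rw [← mul_one (measureFourier (μ s : Measure G) π * _), mul_assoc,
    ← one_mul (measureFourier (μ s : Measure G) π * _), ← mul_assoc, mul_measureFourier_mul_apply,
    measureFourier_apply, hμ.conv]
  refine integral_congr_ae (Filter.Eventually.of_forall fun σ => ?_)
  have := mul_measureFourier_mul_apply (μ t : Measure G) π (π.hom σ).1 1 i j
  simp only [mul_one, one_mul] at this ⊢
  rw [this]
  simp only [UnitaryIrrep.coeff_apply, map_mul, Submonoid.coe_mul]

theorem UnitaryIrrep.norm_coeff_le (π : UnitaryIrrep G) (i j : Fin π.dim) (σ : G) :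
    ‖π.coeff i j σ‖ ≤ 1 :=
  entry_norm_bound_of_unitary (π.hom σ).2 i j

theorem exists_exponent {μ : ℝ≥0 → ProbabilityMeasure G} (hμ : IsConvolutionSemigroup μ)
    (hcentral : ∀ t, IsCentral (μ t : Measure G)) (hsymm : ∀ t, IsSymmetric (μ t : Measure G))
    (π : UnitaryIrrep G) : ∃ a ≤ 0, ∀ t : ℝ≥0,
      measureFourier (μ t : Measure G) π = (Real.exp (t * a) : ℂ) • 1 := by
  choose c hc using fun t => exists_real_measureFourier (hcentral t) (hsymm t) π
  let i : Fin π.dim := ⟨0, π.dim_pos⟩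
  have hci : ∀ t, ((c t : ℝ) : ℂ) = ∫ σ, π.coeff i i σ ∂(μ t : Measure G) := fun t => by
    rw [← measureFourier_apply, hc]
    simp
  have hint : ∀ t, Integrable (π.coeff i i) (μ t : Measure G) := fun t =>
    integrable_of_continuous _ (π.coeff i i).continuous
  have hcre : ∀ t, c t = ∫ σ, (π.coeff i i σ).re ∂(μ t : Measure G) := fun t => by
    have h1 := integral_re (𝕜 := ℂ) (hint t)
    rw [← hci] at h1
    exact h1.symm
  have hcont : Continuous c := by
    -- Weak convergence is tested on real functions; the real part suffices since `c t` is real.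
    let F : BoundedContinuousFunction G ℝ := BoundedContinuousFunction.mkOfCompact
      ⟨fun σ => (π.coeff i i σ).re, Complex.continuous_re.comp (π.coeff i i).continuous⟩
    rw [show c = fun t => ∫ σ, F σ ∂(μ t : Measure G) from funext hcre]
    refine continuous_iff_continuousAt.2 fun t => ?_
    exact (ProbabilityMeasure.tendsto_iff_forall_integral_tendsto.1 (hμ.continuous.tendsto t)) F
  have h0 : c 0 = 1 := by
    have := hci 0
    rw [hμ.zero, integral_dirac' _ _ (π.coeff i i).continuous.stronglyMeasurable,
      UnitaryIrrep.coeff_one, if_pos rfl] at this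
    exact_mod_cast this
  have hmul : ∀ s t, c (s + t) = c s * c t := fun s t => by
    have h1 := measureFourier_add hμ π s t
    rw [hc, hc, hc] at h1
    have h2 := congrFun (congrFun h1 i) i
    simp only [smul_mul_smul_comm, mul_one, Matrix.smul_apply, Matrix.one_apply_eq, smul_eq_mul]
      at h2
    exact_mod_cast h2
  have hle : ∀ t, c t ≤ 1 := fun t => by
    rw [hcre]
    calc ∫ σ, (π.coeff i i σ).re ∂(μ t : Measure G) ≤ ∫ _, (1 : ℝ) ∂(μ t : Measure G) :=
          integral_mono (hint t).re (integrable_const _) fun σ =>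
            (Complex.re_le_norm _).trans (π.norm_coeff_le i i σ)
      _ = 1 := by simp
  obtain ⟨a, ha, hexp⟩ := exists_exp_of_continuous_multiplicative hcont h0 hmul hle
  exact ⟨a, ha, fun t => by rw [hc, hexp]⟩

/-- A scalar matrix is unchanged by a change of basis; this makes the exponent a function of the
equivalence class. -/
theorem measureFourier_of_equiv {μ : Measure G} [IsFiniteMeasure μ] {π ρ : UnitaryIrrep G}
    (h : π ≈ ρ) {c : ℂ} (hc : measureFourier μ ρ = c • 1) : measureFourier μ π = c • 1 := by
  obtain ⟨A, B, hBA, hAB⟩ := UnitaryIrrep.exists_matrix_of_equiv h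
  ext i j
  have := mul_measureFourier_mul_apply μ ρ B A i j
  simp only [← hAB, hc] at this
  rw [measureFourier_apply, ← hBA]
  simp only [UnitaryIrrep.coeff_apply, ← this]
  simp

theorem hunt_toL2_coeff [T2Space G] (μ : ProbabilityMeasure G) (π : UnitaryIrrep G) {c : ℂ}
    (hc : measureFourier (μ : Measure G) π = c • 1) (i j : Fin π.dim) :
    hunt μ (toL2 G (π.coeff i j)) = c • toL2 G (π.coeff i j) := by
  rw [hunt_toL2, ← map_smul]
  congr 1
  ext σ
  have := mul_measureFourier_mul_apply (μ : Measure G) π (π.hom σ).1 1 i j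
  rw [hc] at this
  simp only [mul_one, Matrix.mul_smul, Matrix.smul_apply] at this
  change ∫ τ, π.coeff i j (σ * τ) ∂(μ : Measure G) = c • π.coeff i j σ
  rw [UnitaryIrrep.coeff_apply, this]
  simp only [UnitaryIrrep.coeff_apply, map_mul, Submonoid.coe_mul]

end Fourier

/-! ### Trace and Hilbert–Schmidt norm of real diagonal operators. -/

section DiagonalOperator

universe u v

variable {H : Type u} [NormedAddCommGroup H] [InnerProductSpace ℂ H] [CompleteSpace H]
  {κ : Type v}

theorem adjoint_eq_self_of_diagonal (e : HilbertBasis κ ℂ H) {S : H →L[ℂ] H} {r : κ → ℝ}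
    (hS : ∀ a, S (e a) = (r a : ℂ) • e a) : S.adjoint = S := by
  refine ContinuousLinearMap.ext_on (s := Set.range e) ?_ ?_
  · exact Submodule.dense_iff_topologicalClosure_eq_top.2 e.dense_span
  · rintro _ ⟨a, rfl⟩
    apply e.repr.injective
    ext b
    rw [e.repr_apply_apply, e.repr_apply_apply, ContinuousLinearMap.adjoint_inner_right, hS, hS,
      inner_smul_left, inner_smul_right, Complex.conj_ofReal]
    by_cases h : b = a
    · rw [h]
    · rw [e.orthonormal.2 h, mul_zero, mul_zero]

theorem hasSum_norm_inner_sq {ι : Type*} (b : HilbertBasis ι ℂ H) (x : H) :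
    HasSum (fun i => ‖⟪b i, x⟫_ℂ‖ ^ 2) (‖x‖ ^ 2) := by
  have h := b.hasSum_inner_mul_inner x x
  rw [inner_self_eq_norm_sq_to_K] at h
  have h2 : ∀ i, ⟪x, b i⟫_ℂ * ⟪b i, x⟫_ℂ = ((‖⟪b i, x⟫_ℂ‖ ^ 2 : ℝ) : ℂ) := fun i => by
    rw [← inner_conj_symm, Complex.conj_mul']
    push_cast
    rfl
  simp only [h2] at h
  exact Complex.hasSum_ofReal.1 (by simpa using h)

theorem ofReal_norm_sq_eq_tsum {ι : Type*} (b : HilbertBasis ι ℂ H) (x : H) :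
    ENNReal.ofReal (‖x‖ ^ 2) = ∑' i, ENNReal.ofReal (‖⟪b i, x⟫_ℂ‖ ^ 2) := by
  rw [← (hasSum_norm_inner_sq b x).tsum_eq]
  exact ENNReal.ofReal_tsum_of_nonneg (fun _ => by positivity) (hasSum_norm_inner_sq b x).summable

/-- The Hilbert–Schmidt norm of a diagonal operator can be computed in any basis. -/
theorem hasSum_norm_sq_of_diagonal (e : HilbertBasis κ ℂ H) {S : H →L[ℂ] H} {r : κ → ℝ}
    (hS : ∀ a, S (e a) = (r a : ℂ) • e a) {c : ℝ} (hc : HasSum (fun a => r a ^ 2) c)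
    {ι : Type*} (b : HilbertBasis ι ℂ H) : HasSum (fun i => ‖S (b i)‖ ^ 2) c := by
  have hadj := adjoint_eq_self_of_diagonal e hS
  have hSe : ∀ a, ‖S (e a)‖ ^ 2 = r a ^ 2 := fun a => by
    rw [hS, norm_smul, e.orthonormal.1 a, mul_one, Complex.norm_real, Real.norm_eq_abs, sq_abs]
  -- Parseval in both bases and an exchange of sums, done in `ENNReal`, where no summability is
  -- needed.
  have key : ∑' i, ENNReal.ofReal (‖S (b i)‖ ^ 2) = ENNReal.ofReal c := by
    have h1 : ∀ i, ENNReal.ofReal (‖S (b i)‖ ^ 2) =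
        ∑' a, ENNReal.ofReal (‖⟪b i, S (e a)⟫_ℂ‖ ^ 2) := fun i => by
      rw [ofReal_norm_sq_eq_tsum e]
      refine tsum_congr fun a => ?_
      rw [← ContinuousLinearMap.adjoint_inner_left, hadj, norm_inner_symm]
    simp only [h1]
    rw [ENNReal.tsum_comm]
    simp only [← ofReal_norm_sq_eq_tsum, hSe]
    rw [← hc.tsum_eq]
    exact (ENNReal.ofReal_tsum_of_nonneg (fun _ => by positivity) hc.summable).symm
  have h := ENNReal.hasSum_toReal (f := fun i => ENNReal.ofReal (‖S (b i)‖ ^ 2))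
    (by rw [key]; exact ENNReal.ofReal_ne_top)
  have hc0 : 0 ≤ c := hc.nonneg fun _ => by positivity
  rw [← ENNReal.tsum_toReal_eq (fun _ => ENNReal.ofReal_ne_top), key, ENNReal.toReal_ofReal hc0] at h
  refine h.congr_fun fun i => ?_
  exact (ENNReal.toReal_ofReal (by positivity)).symm

/-- `S` is self-adjoint, so its square is `S* S`: it is positive, equals its own absolute value, and
has diagonal entries `‖S (b i)‖²`. -/
theorem hasTrace_comp_self_of_diagonal (e : HilbertBasis κ ℂ H) {S : H →L[ℂ] H} {r : κ → ℝ}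
    (hS : ∀ a, S (e a) = (r a : ℂ) • e a) {c : ℝ} (hc : HasSum (fun a => r a ^ 2) c) :
    HasTrace (S ∘L S) (c : ℂ) := by
  have hadj := adjoint_eq_self_of_diagonal e hS
  have hpos : 0 ≤ S ∘L S := by
    rw [ContinuousLinearMap.nonneg_iff_isPositive]
    have := ContinuousLinearMap.isPositive_adjoint_comp_self S
    rwa [hadj] at this
  have hinner : ∀ x, ⟪x, (S ∘L S) x⟫_ℂ = ((‖S x‖ ^ 2 : ℝ) : ℂ) := fun x => by
    rw [ContinuousLinearMap.comp_apply, ← ContinuousLinearMap.adjoint_inner_left, hadj,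
      inner_self_eq_norm_sq_to_K]
    push_cast
    rfl
  refine ⟨fun ι b => ?_, fun ι b => ?_⟩
  · rw [CFC.abs_of_nonneg _ hpos]
    simp only [hinner, Complex.ofReal_re]
    exact (hasSum_norm_sq_of_diagonal e hS hc b).summable
  · simp only [hinner]
    exact Complex.hasSum_ofReal.2 (hasSum_norm_sq_of_diagonal e hS hc b)

end DiagonalOperator

theorem hasSum_sigma_of_nonneg {α : Type*} {β : α → Type*} [∀ x, Fintype (β x)]
    {f : (Σ x, β x) → ℝ} (hf : ∀ a, 0 ≤ f a) {c : ℝ} :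
    HasSum f c ↔ HasSum (fun x => ∑ y, f ⟨x, y⟩) c := by
  refine ⟨fun h => h.sigma fun x => hasSum_fintype _, fun h => ?_⟩
  have hs : Summable f := by
    rw [summable_sigma_of_nonneg hf]
    refine ⟨fun x => (hasSum_fintype _).summable, ?_⟩
    simpa only [tsum_fintype] using h.summable
  have := hs.hasSum.sigma fun x => hasSum_fintype fun y => f ⟨x, y⟩
  rw [h.unique this]
  exact hs.hasSum

/-! ### The Hilbert basis of normalized matrix coefficients. -/

section MatrixCoefficients

variable {G : Type*} [Group G] [TopologicalSpace G]

/-- The index type of the matrix coefficients of a family of representatives. -/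
abbrev CoeffIndex (rep : UnitaryDual G → UnitaryIrrep G) :=
  (p : UnitaryDual G) × Fin (rep p).dim × Fin (rep p).dim

variable [IsTopologicalGroup G] [CompactSpace G] [MeasurableSpace G] [BorelSpace G]

/-- The matrix coefficients of a family of representatives, in `L²(G)`. -/
def repCoeff (rep : UnitaryDual G → UnitaryIrrep G) (a : CoeffIndex rep) : L2 G :=
  toL2 G ((rep a.1).coeff a.2.1 a.2.2)

variable {rep : UnitaryDual G → UnitaryIrrep G}

theorem inner_repCoeff_self (a : CoeffIndex rep) :
    ⟪repCoeff rep a, repCoeff rep a⟫_ℂ = ((rep a.1).dim : ℂ)⁻¹ := by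
  rw [repCoeff, UnitaryIrrep.inner_coeff, if_pos ⟨rfl, rfl⟩]

theorem inner_repCoeff_of_ne (hrep : ∀ p, ⟦rep p⟧ = p) {a b : CoeffIndex rep} (h : a ≠ b) :
    ⟪repCoeff rep a, repCoeff rep b⟫_ℂ = 0 := by
  obtain ⟨p, i, j⟩ := a
  obtain ⟨q, k, l⟩ := b
  by_cases hpq : p = q
  · subst hpq
    rw [repCoeff, repCoeff, UnitaryIrrep.inner_coeff, if_neg]
    rintro ⟨rfl, rfl⟩
    exact h rfl
  · refine UnitaryIrrep.inner_coeff_of_not_equiv (fun h' => hpq ?_) _ _ _ _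
    rw [← hrep p, ← hrep q]
    exact (Quotient.sound h').symm

theorem repCoeff_ne_zero (a : CoeffIndex rep) : repCoeff rep a ≠ 0 := by
  rw [← inner_self_ne_zero (𝕜 := ℂ), inner_repCoeff_self]
  exact inv_ne_zero (Nat.cast_ne_zero.2 (rep a.1).dim_pos.ne')

theorem topologicalClosure_span_repCoeff [T2Space G] (hrep : ∀ p, ⟦rep p⟧ = p) :
    (Submodule.span ℂ (Set.range (repCoeff rep))).topologicalClosure = ⊤ := by
  rw [Submodule.topologicalClosure_eq_top_iff, ← le_bot_iff, ← orthogonal_map_coeffSpan]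
  apply Submodule.orthogonal_le
  rw [coeffSpan, Submodule.map_span_le]
  rintro _ ⟨π, i, j, rfl⟩
  have h : π ≈ rep ⟦π⟧ := Quotient.exact (hrep ⟦π⟧).symm
  have h1 := Submodule.mem_map_of_mem (f := (toL2 G).toLinearMap)
    (UnitaryIrrep.coeff_mem_span_of_equiv h i j)
  rw [Submodule.map_span] at h1
  refine Submodule.span_mono ?_ h1
  rintro _ ⟨_, ⟨a, rfl⟩, rfl⟩
  exact ⟨⟨⟦π⟧, a⟩, rfl⟩

theorem orthonormal_repCoeff (hrep : ∀ p, ⟦rep p⟧ = p) :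
    Orthonormal ℂ fun a : CoeffIndex rep => ((√(rep a.1).dim : ℝ) : ℂ) • repCoeff rep a := by
  refine ⟨fun a => ?_, fun a b h => ?_⟩
  · have hd : ((rep a.1).dim : ℂ) ≠ 0 := Nat.cast_ne_zero.2 (rep a.1).dim_pos.ne'
    rw [← sq_eq_sq₀ (norm_nonneg _) zero_le_one, one_pow, ← Complex.ofReal_inj]
    have := inner_self_eq_norm_sq_to_K (𝕜 := ℂ) (((√(rep a.1).dim : ℝ) : ℂ) • repCoeff rep a)
    rw [inner_smul_left, inner_smul_right, inner_repCoeff_self, Complex.conj_ofReal, ← mul_assoc,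
      ← Complex.ofReal_mul, Real.mul_self_sqrt (Nat.cast_nonneg _), Complex.ofReal_natCast,
      mul_inv_cancel₀ hd] at this
    rw [Complex.ofReal_pow, Complex.ofReal_one]
    exact this.symm
  · beta_reduce
    rw [inner_smul_left, inner_smul_right, inner_repCoeff_of_ne hrep h, mul_zero, mul_zero]

/-- The Hilbert basis of normalized matrix coefficients. -/
def repBasis [T2Space G] (hrep : ∀ p, ⟦rep p⟧ = p) : HilbertBasis (CoeffIndex rep) ℂ (L2 G) :=
  HilbertBasis.mk (orthonormal_repCoeff hrep) <| by
    rw [← topologicalClosure_span_repCoeff hrep]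
    refine Submodule.topologicalClosure_mono (Submodule.span_le.2 ?_)
    rintro _ ⟨a, rfl⟩
    have hd : ((√(rep a.1).dim : ℝ) : ℂ) ≠ 0 := by
      rw [Complex.ofReal_ne_zero, Real.sqrt_ne_zero']
      exact Nat.cast_pos.2 (rep a.1).dim_pos
    rw [SetLike.mem_coe, ← Submodule.smul_mem_iff _ hd]
    exact Submodule.subset_span ⟨a, rfl⟩

theorem repBasis_apply [T2Space G] (hrep : ∀ p, ⟦rep p⟧ = p) (a : CoeffIndex rep) :
    repBasis hrep a = ((√(rep a.1).dim : ℝ) : ℂ) • repCoeff rep a := by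
  rw [repBasis, HilbertBasis.coe_mk]

end MatrixCoefficients

/-! ### Continuous densities, their Fourier coefficients and the trace. -/

section Density

variable {G : Type*} [Group G] [TopologicalSpace G] [IsTopologicalGroup G] [CompactSpace G]
  [MeasurableSpace G] [BorelSpace G]

theorem IsDensity.integral_eq {μ : Measure G} {k : G → ℝ} (hk : IsDensity μ k) (f : G → ℂ) :
    ∫ x, f x ∂μ = ∫ x, (k x : ℂ) * f x ∂haar G := by
  obtain ⟨hm, h0, rfl⟩ := hk
  rw [integral_withDensity_eq_integral_toReal_smul₀ hm.ennreal_ofReal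
    (Filter.Eventually.of_forall fun _ => ENNReal.ofReal_lt_top)]
  refine integral_congr_ae ?_
  filter_upwards [h0] with x hx
  rw [ENNReal.toReal_ofReal hx, Complex.real_smul]

/-- A continuous real density as a complex-valued continuous function. -/
def complexDensity {k : G → ℝ} (hk : Continuous k) : C(G, ℂ) :=
  ⟨fun x => (k x : ℂ), Complex.continuous_ofReal.comp hk⟩

theorem inner_toL2_complexDensity {μ : Measure G} {k : G → ℝ} (hd : IsDensity μ k)
    (hk : Continuous k) (f : C(G, ℂ)) :
    ⟪toL2 G f, toL2 G (complexDensity hk)⟫_ℂ = conj (∫ x, f x ∂μ) := by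
  rw [inner_toL2, ← integral_conj, hd.integral_eq]
  rfl

theorem norm_sq_toL2_complexDensity {μ : ProbabilityMeasure G} {k : G → ℝ}
    (hd : IsDensity (μ : Measure G) k) (hk : Continuous k) :
    ((‖toL2 G (complexDensity hk)‖ ^ 2 : ℝ) : ℂ) = huntC μ (complexDensity hk) 1 := by
  have h : huntC μ (complexDensity hk) 1 = ∫ x, complexDensity hk (1 * x) ∂(μ : Measure G) := rfl
  rw [h, hd.integral_eq]
  have h2 := inner_self_eq_norm_sq_to_K (𝕜 := ℂ) (toL2 G (complexDensity hk))
  rw [inner_toL2] at h2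
  rw [Complex.ofReal_pow]
  refine h2.symm.trans (integral_congr_ae (Filter.Eventually.of_forall fun x => ?_))
  simp [complexDensity]

variable {rep : UnitaryDual G → UnitaryIrrep G}

theorem inner_repCoeff_complexDensity {μ : Measure G} {k : G → ℝ} (hd : IsDensity μ k)
    (hk : Continuous k) (a : CoeffIndex rep) {c : ℝ}
    (hc : measureFourier μ (rep a.1) = (c : ℂ) • 1) :
    ⟪repCoeff rep a, toL2 G (complexDensity hk)⟫_ℂ = if a.2.1 = a.2.2 then (c : ℂ) else 0 := by
  rw [repCoeff, inner_toL2_complexDensity hd, ← measureFourier_apply, hc]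
  by_cases h : a.2.1 = a.2.2 <;> simp [h]

theorem hunt_repBasis [T2Space G] (hrep : ∀ p, ⟦rep p⟧ = p) {μ : ProbabilityMeasure G}
    {c : UnitaryDual G → ℝ} (hc : ∀ p, measureFourier (μ : Measure G) (rep p) = (c p : ℂ) • 1)
    (a : CoeffIndex rep) : hunt μ (repBasis hrep a) = (c a.1 : ℂ) • repBasis hrep a := by
  rw [repBasis_apply, map_smul, repCoeff, hunt_toL2_coeff μ _ (hc a.1), smul_comm]

/-- Both sides are continuous, so equal Fourier coefficients suffice; self-adjointness of `hunt μ`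
multiplies the coefficient `c` of `k` by another `c`. This gives equality at every point, in
particular at `1`. -/
theorem huntC_complexDensity [T2Space G] (hrep : ∀ p, ⟦rep p⟧ = p) {μ ν : ProbabilityMeasure G}
    {c : UnitaryDual G → ℝ} (hμ : ∀ p, measureFourier (μ : Measure G) (rep p) = (c p : ℂ) • 1)
    (hν : ∀ p, measureFourier (ν : Measure G) (rep p) = ((c p ^ 2 : ℝ) : ℂ) • 1)
    {k l : G → ℝ} (hdk : IsDensity (μ : Measure G) k) (hk : Continuous k)
    (hdl : IsDensity (ν : Measure G) l) (hl : Continuous l) :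
    huntC μ (complexDensity hk) = complexDensity hl := by
  apply toL2_injective
  apply (repBasis hrep).repr.injective
  ext a
  rw [HilbertBasis.repr_apply_apply, HilbertBasis.repr_apply_apply, ← hunt_toL2,
    ← ContinuousLinearMap.adjoint_inner_left,
    adjoint_eq_self_of_diagonal (repBasis hrep) (hunt_repBasis hrep hμ), hunt_repBasis hrep hμ,
    repBasis_apply, inner_smul_left, inner_smul_left, inner_smul_left, Complex.conj_ofReal,
    inner_repCoeff_complexDensity hdk hk a (hμ a.1),
    inner_repCoeff_complexDensity hdl hl a (hν a.1)]
  split_ifs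
  · push_cast
    ring
  · simp

/-- Parseval for `k`, whose squared norm is `l 1`. Only the `d` diagonal coefficients of each class
contribute, each `d * c²` after normalization. -/
theorem hasSum_dim_sq [T2Space G] (hrep : ∀ p, ⟦rep p⟧ = p) {μ ν : ProbabilityMeasure G}
    {c : UnitaryDual G → ℝ} (hμ : ∀ p, measureFourier (μ : Measure G) (rep p) = (c p : ℂ) • 1)
    (hν : ∀ p, measureFourier (ν : Measure G) (rep p) = ((c p ^ 2 : ℝ) : ℂ) • 1)
    {k l : G → ℝ} (hdk : IsDensity (μ : Measure G) k) (hk : Continuous k)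
    (hdl : IsDensity (ν : Measure G) l) (hl : Continuous l) :
    HasSum (fun p => ((rep p).dim : ℝ) ^ 2 * c p ^ 2) (l 1) := by
  have hnorm : ‖toL2 G (complexDensity hk)‖ ^ 2 = l 1 := by
    rw [← Complex.ofReal_inj, norm_sq_toL2_complexDensity hdk,
      huntC_complexDensity hrep hμ hν hdk hk hdl hl]
    rfl
  have h := hasSum_norm_inner_sq (repBasis hrep) (toL2 G (complexDensity hk))
  rw [hnorm, hasSum_sigma_of_nonneg fun _ => by positivity] at h
  refine h.congr_fun fun p => ?_
  have h1 : ∀ y : Fin (rep p).dim × Fin (rep p).dim,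
      ‖⟪repBasis hrep ⟨p, y⟩, toL2 G (complexDensity hk)⟫_ℂ‖ ^ 2 =
        if y.1 = y.2 then (rep p).dim * c p ^ 2 else 0 := fun y => by
    rw [repBasis_apply, inner_smul_left, Complex.conj_ofReal,
      inner_repCoeff_complexDensity hdk hk _ (hμ p)]
    split_ifs
    · rw [norm_mul, mul_pow, Complex.norm_real, Complex.norm_real, Real.norm_eq_abs,
        Real.norm_eq_abs, sq_abs, sq_abs, Real.sq_sqrt (Nat.cast_nonneg _)]
    · simp
  simp only [h1, Fintype.sum_prod_type, Finset.sum_ite_eq, Finset.mem_univ, if_true,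
    Finset.sum_const, Finset.card_univ, Fintype.card_fin, nsmul_eq_mul]
  ring

theorem hasTrace_hunt [T2Space G] (hrep : ∀ p, ⟦rep p⟧ = p) {μ ν : ProbabilityMeasure G}
    {c : UnitaryDual G → ℝ} (hμ : ∀ p, measureFourier (μ : Measure G) (rep p) = (c p : ℂ) • 1)
    (hν : ∀ p, measureFourier (ν : Measure G) (rep p) = ((c p ^ 2 : ℝ) : ℂ) • 1) {s : ℝ}
    (hs : HasSum (fun p => ((rep p).dim : ℝ) ^ 2 * c p ^ 2) s) :
    HasTrace (hunt ν) (s : ℂ) := by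
  have hcomp : hunt ν = hunt μ ∘L hunt μ := by
    refine ContinuousLinearMap.ext_on (s := Set.range (repBasis hrep))
      (Submodule.dense_iff_topologicalClosure_eq_top.2 (repBasis hrep).dense_span) ?_
    rintro _ ⟨a, rfl⟩
    rw [hunt_repBasis hrep hν, ContinuousLinearMap.comp_apply, hunt_repBasis hrep hμ, map_smul,
      hunt_repBasis hrep hμ, smul_smul, sq, Complex.ofReal_mul]
  rw [hcomp]
  refine hasTrace_comp_self_of_diagonal (repBasis hrep) (hunt_repBasis hrep hμ) ?_
  rw [hasSum_sigma_of_nonneg fun _ => by positivity]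
  refine hs.congr_fun fun p => ?_
  simp only [Finset.sum_const, Finset.card_univ, Fintype.card_prod, Fintype.card_fin,
    nsmul_eq_mul, Nat.cast_mul]
  ring

end Density

end HuntSemigroup

end

/-! ### The theorem. -/

theorem theorem5p5 {G : Type*} [Group G] [TopologicalSpace G] [IsTopologicalGroup G]
    [CompactSpace G] [T2Space G] [MeasurableSpace G] [BorelSpace G]
    (μ : ℝ≥0 → ProbabilityMeasure G) (hμ : IsConvolutionSemigroup μ)
    (hcentral : ∀ t, IsCentral (μ t : Measure G))
    (hsymm : ∀ t, IsSymmetric (μ t : Measure G)) :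
    ∃ α : UnitaryDual G → ℝ,
      -- `α_π ≤ 0` is the number with `μ̂_t(π) = e^{t α_π} I_π` for all `t ≥ 0`
      (∀ p, α p ≤ 0) ∧
      (∀ (t : ℝ≥0) (π : UnitaryIrrep G),
        measureFourier (μ t : Measure G) π = (Real.exp (t * α ⟦π⟧) : ℂ) • 1) ∧
      -- for every choice of one representative (a unitary matrix representation) in each class
      ∀ rep : UnitaryDual G → UnitaryIrrep G, (∀ p, ⟦rep p⟧ = p) →
        -- (1) the `π_ij` are a complete orthogonal set of eigenvectors of `T_t`
        (∀ t : ℝ≥0,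
          (∀ (p : UnitaryDual G) (i j : Fin (rep p).dim),
            toL2 G ((rep p).coeff i j) ≠ 0 ∧
            hunt (μ t) (toL2 G ((rep p).coeff i j)) =
              (Real.exp (t * α p) : ℂ) • toL2 G ((rep p).coeff i j)) ∧
          (Pairwise fun a b : (p : UnitaryDual G) × Fin (rep p).dim × Fin (rep p).dim =>
            ⟪toL2 G ((rep a.1).coeff a.2.1 a.2.2),
              toL2 G ((rep b.1).coeff b.2.1 b.2.2)⟫_ℂ = 0) ∧
          (Submodule.span ℂ (Set.range
            fun a : (p : UnitaryDual G) × Fin (rep p).dim × Fin (rep p).dim =>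
              toL2 G ((rep a.1).coeff a.2.1 a.2.2))).topologicalClosure = ⊤) ∧
        -- (2) `k_t(e) = Tr(T_t) = ∑ d_π² e^{t α_π}` if all densities are continuous
        (∀ k : ℝ≥0 → G → ℝ,
          (∀ t, 0 < t → IsDensity (μ t : Measure G) (k t) ∧ Continuous (k t)) →
          ∀ t, 0 < t →
            HasTrace (hunt (μ t)) (k t 1 : ℂ) ∧
            HasSum (fun p => ((rep p).dim : ℝ) ^ 2 * Real.exp (t * α p)) (k t 1)) := by
  choose a ha hexp using exists_exponent hμ hcentral hsymm
  -- The exponent of a class is read off at its chosen representative and transported to all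
  -- equivalent ones.
  have hα : ∀ (t : ℝ≥0) (π : UnitaryIrrep G), measureFourier (μ t : Measure G) π =
      (Real.exp (t * a (Quotient.out (⟦π⟧ : UnitaryDual G))) : ℂ) • 1 := fun t π =>
    measureFourier_of_equiv (Quotient.exact (Quotient.out_eq _).symm) (hexp _ t)
  refine ⟨fun p => a p.out, fun p => ha _, hα, fun rep hrep => ?_⟩
  have hrepα : ∀ (t : ℝ≥0) (p : UnitaryDual G), measureFourier (μ t : Measure G) (rep p) =
      (Real.exp (t * a p.out) : ℂ) • 1 := fun t p => by
    have := hα t (rep p)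
    rwa [hrep] at this
  refine ⟨fun t => ⟨fun p i j => ⟨repCoeff_ne_zero (rep := rep) ⟨p, i, j⟩, ?_⟩, ?_, ?_⟩, ?_⟩
  · exact hunt_toL2_coeff (μ t) (rep p) (hrepα t p) i j
  · exact fun x y hxy => inner_repCoeff_of_ne hrep hxy
  · exact topologicalClosure_span_repCoeff hrep
  · intro k hk t ht
    -- The trace lemmas are applied with `μ (t / 2)` as the square root of `μ t`; `t > 0` ensures
    -- that `μ (t / 2)` also has a continuous density.
    have hsq : ∀ p : UnitaryDual G,
        Real.exp ((t / 2 : ℝ≥0) * a p.out) ^ 2 = Real.exp (t * a p.out) := fun p => by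
      rw [← Real.exp_nat_mul]
      congr 1
      push_cast
      ring
    have hν : ∀ p, measureFourier (μ t : Measure G) (rep p) =
        ((Real.exp ((t / 2 : ℝ≥0) * a p.out) ^ 2 : ℝ) : ℂ) • 1 := fun p => by
      rw [hsq, hrepα]
    obtain ⟨hd, hc⟩ := hk t ht
    obtain ⟨hd', hc'⟩ := hk (t / 2) (half_pos ht)
    have hsum := hasSum_dim_sq hrep (hrepα (t / 2)) hν hd' hc' hd hc
    refine ⟨hasTrace_hunt hrep (hrepα (t / 2)) hν hsum, ?_⟩
    simpa only [hsq] using hsum
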